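/- Let $f$ be a field of characteristic $0$, let $\lambda,\mu\in f$, and let $F_{\lambda\mu}=f[[t]]\,t^\mu(dt)^{-\lambda}$ be the space of formal densities $h(t)\,t^\mu(dt)^{-\lambda}$, $h\in f[[t]]$; let $x_j$ be the linear form taking such a density to the coefficient of $t^j$ in $h$. For $n\ge 1$ let $L_n$ be the Lie algebra of derivations $a(t)\frac{d}{dt}$ of $f[[t]]$ over $f$ with $a\in t^{n+1}f[[t]]$, acting on $F_{\lambda\mu}$ by Lie derivatives, $h\mapsto ah'+(\mu\,a/t-\lambda a')h$, and let $G_n$ be the group of $f$-automorphisms $g$ of the field $f((t))$ with $g(t)=t+o(t^n)$, acting on $F_{\lambda\mu}$ by $h\mapsto g(h)\,(g(t)/t)^\mu\,(g(t)')^{-\lambda}$ (powers of series with constant term $1$ are given by the binomial series). Let $I^{n}_{\lambda\mu}\subseteq f[x_0,x_1,\dots]$ be the algebra of polynomial invariants of this action; the invariants of $L_n$ and of $G_n$ are understood in the usual sense. Let $m\ge 0$ be an integer. Then the group $G_{m+1}$ and the Lie algebra $L_{m+1}$ have the same algebra of polynomial invariants $I^{m+1}_{\lambda\mu}$, and: 1.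 If $\mu\neq(m+k+1)\lambda$ for every positive integer $k$, then $I^{m+1}_{\lambda\mu}=f[x_0,\dots,x_m]$. 2. If $\lambda=\mu=0$, then $I^{m+1}_{\lambda\mu}=f[x_0,\dots,x_m,x_{m+1}]$. 3. If $\lambda\ne0$, $\mu=(m+k+1)\lambda$ for a positive integer $k$, and $-1/\lambda\neq n$ for every positive integer $n<k$, then $$I^{m+1}_{\lambda\mu}=f\bigl[x_0,\dots,x_m,P^{(-1/\lambda)}_{mk}(x_0,\dots,x_{m+k})\bigr],$$ where, for $\lambda\neq0$, the polynomials $P^{(-1/\lambda)}_{mk}\in f[x_0,\dots,x_{m+k}]$, $k\ge1$, are defined by the generating function $$\sum_{k=1}^\infty P^{(-1/\lambda)}_{mk}(x_0,\dots,x_{m+k})\,z^k=\frac{\bigl(\sum_{i=0}^\infty x_ix_0^{i-1}z^i\bigr)^{-1/\lambda}-\bigl(\sum_{i=0}^m x_ix_0^{i-1}z^i\bigr)^{-1/\lambda}}{x_0^mz^m}.$$ 4. If $-1/\lambda=n$ for a positive integer $n$ and $\mu=(m+k+1)\lambda$ for a positive integer $k>n$, then $P^{(n)}_{mk}$ is divisible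 by $x_0^{k-n}$ and $$I^{m+1}_{\lambda\mu}=f\bigl[x_0,\dots,x_m,P^{(n)}_{mk}(x_0,\dots,x_{m+k})/x_0^{k-n}\bigr].$$ -/

import Mathlib

open PowerSeries

namespace FormalDensity

noncomputable section

variable {f : Type*} [Field f]

/-! ### Fractional powers of power series -/

/-- For a power series `u` with constant term `1` over an `f`-algebra `A`, the series
`u ^ a = ∑ j, (a choose j) (u - 1) ^ j` with exponent `a` in the field `f` of characteristic `0`. -/
def seriesPow [CharZero f] {A : Type*} [CommRing A] [Algebra f A] (u : A⟦X⟧) (a : f) : A⟦X⟧ :=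
  PowerSeries.subst (u - 1) (binomialSeries A a)

/-! ### Densities

An element `h(t) t ^ μ (dt) ^ (-λ)` of the space `f[[t]] t ^ μ (dt) ^ (-λ)` is represented by
the power series `h`. The linear form `x_j` is the coefficient of `t ^ j` in `h`, and polynomial
functions on the space are the elements of `MvPolynomial ℕ f = f[x_0, x_1, ...]`. -/

/-- The value of the polynomial function `P` at the density with coefficient series `h`. -/
def polyEval (h : f⟦X⟧) : MvPolynomial ℕ f →ₐ[f] f :=
  MvPolynomial.aeval fun j => coeff j h

/-! ### The Lie algebras `L_n` -/

/-- The Lie algebra `L_n` of the vector fields `a(t) d/dt` (derivations of `f[[t]]` over `f`) such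
that `t ^ (n + 1)` divides `a(t)`, the value of the derivation at `t`. -/
def vectorFields (f : Type*) [Field f] (n : ℕ) : LieSubalgebra f (Derivation f f⟦X⟧ f⟦X⟧) where
  carrier := {D | (X : f⟦X⟧) ^ (n + 1) ∣ D X}
  add_mem' := fun ha hb => dvd_add ha hb
  zero_mem' := dvd_zero _
  smul_mem' := fun c D hD => by
    obtain ⟨r, hr⟩ := hD
    exact ⟨c • r, by rw [Derivation.smul_apply, hr, mul_smul_comm]⟩
  lie_mem' := by
    have key : ∀ D E : Derivation f f⟦X⟧ f⟦X⟧, (X : f⟦X⟧) ^ (n + 1) ∣ D X →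
        (X : f⟦X⟧) ^ (n + 1) ∣ E X → (X : f⟦X⟧) ^ (n + 1) ∣ D (E X) := by
      rintro D E hD ⟨r, hr⟩
      rw [hr, Derivation.leibniz, Derivation.leibniz_pow]
      simp only [smul_eq_mul, nsmul_eq_mul]
      exact dvd_add (Dvd.intro _ rfl)
        (((hD.mul_left _).mul_left _).mul_left _)
    intro D E hD hE
    change (X : f⟦X⟧) ^ (n + 1) ∣ ⁅D, E⁆ X
    rw [Derivation.commutator_apply]
    exact dvd_sub (key D E hD hE) (key E D hE hD)

/-- The Lie derivative of `h t ^ μ (dt) ^ (-λ)` along `a d/dt`, where `a = D t` is divisible by `t`: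
its coefficient series is `a h' + (μ a / t - λ a') h`. -/
def lieDensity (lam mu : f) (D : Derivation f f⟦X⟧ f⟦X⟧) : f⟦X⟧ →ₗ[f] f⟦X⟧ :=
  (D : f⟦X⟧ →ₗ[f] f⟦X⟧) + LinearMap.mulLeft f
    (mu • PowerSeries.mk (fun j => coeff (j + 1) (D X)) - lam • derivative f (D X))

/-- The action of a vector field on `f[x_0, x_1, ...]`: the derivation which on the linear forms is
the dual representation `x_j ↦ -(x_j ∘ D) = -∑ i ≤ j, x_j (D e_i) x_i`, with
`e_i = t ^ (i + μ) (dt) ^ (-λ)`. -/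
def liePoly (lam mu : f) (D : Derivation f f⟦X⟧ f⟦X⟧) :
    Derivation f (MvPolynomial ℕ f) (MvPolynomial ℕ f) :=
  MvPolynomial.mkDerivation f fun j =>
    -∑ i ∈ Finset.range (j + 1),
      coeff j (lieDensity lam mu D (X ^ i)) • (MvPolynomial.X i : MvPolynomial ℕ f)

/-- The algebra of polynomial invariants of `L_n` on `f[[t]] t ^ μ (dt) ^ (-λ)`. -/
def lieInvariants (lam mu : f) (n : ℕ) : Subalgebra f (MvPolynomial ℕ f) where
  carrier := {P | ∀ D ∈ vectorFields f n, liePoly lam mu D P = 0}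
  add_mem' := fun ha hb D hD => by rw [map_add, ha D hD, hb D hD, add_zero]
  mul_mem' := fun ha hb D hD => by
    rw [Derivation.leibniz, ha D hD, hb D hD, smul_zero, smul_zero, add_zero]
  algebraMap_mem' := fun c D _ => Derivation.map_algebraMap _ c

/-! ### The groups `G_n` -/

/-- The uniformizer `t` of the field `f((t))`. -/
def tL (f : Type*) [Field f] : LaurentSeries f := ((X : f⟦X⟧) : LaurentSeries f)

/-- The group `G_n`: the automorphisms `g` of the field `f((t))` over `f` such that
`g(t) = t + o(t ^ n)`. -/
def formalGroup (f : Type*) [Field f] (n : ℕ) : Set (LaurentSeries f ≃ₐ[f] LaurentSeries f) :=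
  {g | ∃ r : f⟦X⟧, g (tL f) = tL f + ((X ^ (n + 1) * r : f⟦X⟧) : LaurentSeries f)}

/-- The power series with the same coefficients in non-negative degrees; it is `x` itself when `x`
lies in `f[[t]]`, and it is used only for such `x`. -/
def regularPart (x : LaurentSeries f) : f⟦X⟧ := PowerSeries.mk fun j => x.coeff (j : ℤ)

/-- The action of `g` in `G_n`, `n > 0`, sends `h t ^ μ (dt) ^ (-λ)` to
`g(h) g(t) ^ μ (d g(t)) ^ (-λ) = (g(h) (g(t) / t) ^ μ (g(t)') ^ (-λ)) t ^ μ (dt) ^ (-λ)`. -/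
def groupDensity [CharZero f] (lam mu : f) (g : LaurentSeries f ≃ₐ[f] LaurentSeries f)
    (h : f⟦X⟧) : f⟦X⟧ :=
  regularPart (g (h : LaurentSeries f)) * seriesPow (regularPart (g (tL f) / tL f)) mu *
    seriesPow (derivative f (regularPart (g (tL f)))) (-lam)

/-- The algebra of polynomial invariants of `G_n` on `f[[t]] t ^ μ (dt) ^ (-λ)`. -/
def groupInvariants [CharZero f] (lam mu : f) (n : ℕ) : Subalgebra f (MvPolynomial ℕ f) where
  carrier := {P | ∀ g ∈ formalGroup f n, ∀ h : f⟦X⟧,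
    polyEval (groupDensity lam mu g h) P = polyEval h P}
  add_mem' := fun ha hb g hg h => by rw [map_add, map_add, ha g hg h, hb g hg h]
  mul_mem' := fun ha hb g hg h => by rw [map_mul, map_mul, ha g hg h, hb g hg h]
  algebraMap_mem' := fun c g _ h => by rw [AlgHom.commutes, AlgHom.commutes]

/-! ### The polynomials `P_{mk}^{(a)}` -/

/-- The series `∑ i, x_i x_0 ^ (i - 1) z ^ i` over `f[x_0, x_1, ...]`; its term with `i = 0`
is `x_0 x_0 ^ (-1) = 1`. -/
def genSeries (f : Type*) [Field f] : (MvPolynomial ℕ f)⟦X⟧ :=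
  PowerSeries.mk fun i =>
    if i = 0 then 1 else MvPolynomial.X i * MvPolynomial.X 0 ^ (i - 1)

/-- The sum of the terms of `genSeries` with `i ≤ m`. -/
def genSeriesTrunc (f : Type*) [Field f] (m : ℕ) : (MvPolynomial ℕ f)⟦X⟧ :=
  PowerSeries.mk fun i => if i ≤ m then coeff i (genSeries f) else 0

/-- The polynomial `P_{mk}^{(a)}`: the coefficient of `z ^ k` in
`(genSeries ^ a - genSeriesTrunc m ^ a) / (x_0 z) ^ m`. -/
def fracRes [CharZero f] (a : f) (m k : ℕ) : MvPolynomial ℕ f :=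
  MvPolynomial.divMonomial
    (coeff (m + k) (seriesPow (genSeries f) a - seriesPow (genSeriesTrunc f m) a))
    (Finsupp.single 0 m)

end

end FormalDensity

/-! The invariants are squeezed. An explicit algebra is shown to consist of group invariants, group
invariants are Lie invariants (`groupInvariants_le_lieInvariants`, by differentiating along t ↦ t(1
+ sρ)), and the Lie invariants are shown to lie in the explicit algebra.

Upper bound. The field t^(s+1) d/dt sends x_j to -(j - s + μ - λ(s+1)) x_(j-s), or to 0 if j < s.
For s = M it acts on f[x_0, ..., x_M] as a multiple of x_0 ∂/∂x_M, and the multiple is nonzero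
unless μ = (M+1)λ. So outside this resonance an invariant cannot have x_M, M > m, as its last
variable (`pderiv_eq_zero_of_liePoly`), and descent on the last variable settles the generic case.
If λ = μ = 0, the choice s = M - 1 removes all variables beyond x_(m+1).

The extra invariant. If λ ≠ 0 and μ = (N+1)λ with N = m + k, the power -1/λ of a density is the
1-form h^(-1/λ) t^(-N-1) dt, whose residue does not depend on the coordinate
(`coeff_seriesPow_substDensity`). Removing the part in x_0, ..., x_m and the superfluous powers of
x_0 turns this residue into a polynomial invariant S, which is `residuePoly`.

Generation. Let K = f[x_0, ..., x_m]. Now N is the only resonant index, so invariants lie in f[x_0,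
..., x_N], and those free of x_N lie in K. Since ∂/∂x_N preserves the invariants, induction on the
degree in x_N gives ∂Q/∂x_N = G(S) with G over K. As ∂S/∂x_N = c x_0^d, an antiderivative H of G
makes c x_0^d Q - H(S) free of x_N, so x_0^d Q lies in K[S]. The factor x_0^d can be cancelled
because x_0 does not divide every ∂S/∂x_j, j > m (`prime_dvd_coeff_of_dvd_eval`,
`exists_eval_eq_of_pderiv`). -/

namespace FormalDensity

/-! ### Coefficients of substituted power series -/

section SubstitutionCoefficients

variable {R S : Type*} [CommRing R] [CommRing S] [Algebra R S]

theorem coeff_pow_eq_zero_of_lt {γ : S⟦X⟧} (hγ : constantCoeff γ = 0) {i n : ℕ} (h : n < i) :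
    coeff n (γ ^ i) = 0 := by
  obtain ⟨u, rfl⟩ := X_dvd_iff.2 hγ
  rw [mul_pow, coeff_X_pow_mul', if_neg (by omega)]

theorem coeff_subst_eq_sum {γ : S⟦X⟧} (hγ : constantCoeff γ = 0) (F : R⟦X⟧) {n N : ℕ}
    (hN : n < N) :
    coeff n (F.subst γ) = ∑ i ∈ Finset.range N, coeff i F • coeff n (γ ^ i) := by
  rw [coeff_subst' (HasSubst.of_constantCoeff_zero' hγ)]
  refine finsum_eq_sum_of_support_subset _ fun i hi => ?_
  by_contra h
  refine hi ?_
  simp only [Finset.coe_range, Set.mem_Iio, not_lt] at h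
  simp only
  rw [coeff_pow_eq_zero_of_lt hγ (by omega), smul_zero]

theorem constantCoeff_map_apply {T : Type*} [CommRing T] (φ : S →+* T) (u : S⟦X⟧) :
    constantCoeff (PowerSeries.map φ u) = φ (constantCoeff u) := by
  rw [← coeff_zero_eq_constantCoeff_apply, coeff_map, coeff_zero_eq_constantCoeff_apply]

theorem constantCoeff_rescale_apply (c : S) (u : S⟦X⟧) :
    constantCoeff (rescale c u) = constantCoeff u := by
  rw [← coeff_zero_eq_constantCoeff_apply, coeff_rescale, pow_zero, one_mul,
    coeff_zero_eq_constantCoeff_apply]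

end SubstitutionCoefficients

/-! ### Powers of series with exponent in the field -/

section SeriesPow

variable {f : Type*} [Field f] [CharZero f] {A : Type*} [CommRing A] [Algebra f A]

theorem constantCoeff_sub_one {u : A⟦X⟧} (hu : constantCoeff u = 1) :
    constantCoeff (u - 1) = 0 := by simp [hu]

theorem coeff_seriesPow {u : A⟦X⟧} (hu : constantCoeff u = 1) (a : f) (n : ℕ) :
    coeff n (seriesPow u a) =
      ∑ r ∈ Finset.range (n + 1), Ring.choose a r • coeff n ((u - 1) ^ r) := by
  rw [seriesPow, coeff_subst_eq_sum (constantCoeff_sub_one hu) _ n.lt_succ_self]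
  simp

@[simp]
theorem constantCoeff_seriesPow {u : A⟦X⟧} (hu : constantCoeff u = 1) (a : f) :
    constantCoeff (seriesPow u a) = 1 := by
  rw [← coeff_zero_eq_constantCoeff_apply, coeff_seriesPow hu]
  simp

theorem map_seriesPow {B : Type*} [CommRing B] [Algebra f B] (φ : A →ₐ[f] B) {u : A⟦X⟧}
    (hu : constantCoeff u = 1) (a : f) :
    PowerSeries.map (φ : A →+* B) (seriesPow u a) =
      seriesPow (PowerSeries.map (φ : A →+* B) u) a := by
  ext n
  rw [coeff_map, coeff_seriesPow hu,
    coeff_seriesPow (by rw [constantCoeff_map_apply, hu, map_one]), map_sum]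
  refine Finset.sum_congr rfl fun i _ => ?_
  rw [← map_one (PowerSeries.map (φ : A →+* B)), ← map_sub, ← map_pow, coeff_map]
  exact map_smul φ _ _

theorem seriesPow_natCast {u : A⟦X⟧} (hu : constantCoeff u = 1) (n : ℕ) :
    seriesPow u (n : f) = u ^ n := by
  have h := HasSubst.of_constantCoeff_zero' (constantCoeff_sub_one hu)
  rw [seriesPow, binomialSeries_nat, subst_pow h, subst_add h, subst_X h]
  have h1 : subst (u - 1) (1 : A⟦X⟧) = (1 : A⟦X⟧) := by
    rw [← coe_substAlgHom h, map_one]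
  rw [h1, add_sub_cancel]

theorem seriesPow_zero {u : A⟦X⟧} (hu : constantCoeff u = 1) : seriesPow u (0 : f) = 1 := by
  simpa using seriesPow_natCast (f := f) hu 0

theorem seriesPow_add {u : A⟦X⟧} (hu : constantCoeff u = 1) (a b : f) :
    seriesPow u (a + b) = seriesPow u a * seriesPow u b := by
  rw [seriesPow, binomialSeries_add,
    subst_mul (HasSubst.of_constantCoeff_zero' (constantCoeff_sub_one hu))]
  rfl

/-- The recursion (n+1) C(a, n+1) = (a - n) C(a, n), arranged as the coefficient of z^n in (1 + z)
B' = a B for the binomial series B. -/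
theorem succ_mul_choose_add (a : f) (n : ℕ) :
    ((n : f) + 1) * Ring.choose a (n + 1) + n * Ring.choose a n = a * Ring.choose a n := by
  have h := Ring.descPochhammer_eq_factorial_smul_choose a (n + 1)
  have h' := Ring.descPochhammer_eq_factorial_smul_choose a n
  rw [descPochhammer_succ_right, Polynomial.smeval_mul, h'] at h
  have hn : ((n.factorial : ℕ) : f) ≠ 0 := Nat.cast_ne_zero.2 n.factorial_ne_zero
  have e : (Polynomial.X - (n : Polynomial ℤ)).smeval a = a - n := by
    rw [Polynomial.smeval_sub, Polynomial.smeval_X, pow_one, Polynomial.smeval_natCast]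
    simp
  rw [e, nsmul_eq_mul, nsmul_eq_mul, Nat.factorial_succ] at h
  push_cast at h
  apply mul_left_cancel₀ hn
  linear_combination -h

theorem one_add_X_mul_derivative_binomialSeries (a : f) :
    (1 + X) * derivative A (binomialSeries A a) = a • binomialSeries A a := by
  ext n
  rw [add_mul, one_mul, map_add, coeff_derivative, coeff_smul, binomialSeries_coeff,
    binomialSeries_coeff]
  have h : coeff n (X * derivative A (binomialSeries A a)) = (n : A) * Ring.choose a n • 1 := by
    cases n with
    | zero => simp
    | succ n =>
      rw [coeff_succ_X_mul, coeff_derivative, binomialSeries_coeff, mul_comm]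
      push_cast
      rfl
  rw [h, smul_smul, ← succ_mul_choose_add, add_smul, Algebra.smul_def, Algebra.smul_def,
    Algebra.smul_def, Algebra.smul_def]
  simp only [map_mul, map_add, map_natCast, map_one]
  ring

theorem mul_derivative_seriesPow {u : A⟦X⟧} (hu : constantCoeff u = 1) (a : f) :
    u * derivative A (seriesPow u a) = a • (seriesPow u a * derivative A u) := by
  have h := HasSubst.of_constantCoeff_zero' (constantCoeff_sub_one hu)
  have h1 : subst (u - 1) (1 : A⟦X⟧) = (1 : A⟦X⟧) := by
    rw [← coe_substAlgHom h, map_one]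
  have key := congrArg (subst (u - 1)) (one_add_X_mul_derivative_binomialSeries (A := A) a)
  rw [subst_mul h, subst_add h, subst_X h, h1, add_sub_cancel] at key
  have hs : subst (u - 1) (a • binomialSeries A a) = a • seriesPow u a := by
    rw [seriesPow, algebra_compatible_smul A, subst_smul h, ← algebra_compatible_smul A]
  rw [hs] at key
  rw [seriesPow, derivative_subst h, ← mul_assoc, key, map_sub, Derivation.map_one_eq_zero,
    sub_zero, smul_mul_assoc]
  rfl

/-- Equal logarithmic derivatives force v / w to have derivative 0, hence to be constant in the
absence of torsion. The laws of exponents below follow by comparing logarithmic derivatives. -/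
theorem eq_of_mul_derivative_eq [IsAddTorsionFree A] {u v w : A⟦X⟧} (hu : constantCoeff u = 1)
    (hv : constantCoeff v = 1) (hw : constantCoeff w = 1) {c : A⟦X⟧}
    (h1 : u * derivative A v = c * v) (h2 : u * derivative A w = c * w) : v = w := by
  have unit_of : ∀ {x : A⟦X⟧}, constantCoeff x = 1 → IsUnit x := fun hx =>
    isUnit_iff_constantCoeff.2 (hx ▸ isUnit_one)
  obtain ⟨w', rfl⟩ := unit_of hw
  have hinv : constantCoeff ((w'⁻¹ : A⟦X⟧ˣ) : A⟦X⟧) = 1 := by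
    have := congrArg constantCoeff (Units.mul_inv w')
    rwa [map_mul, hw, one_mul, map_one] at this
  have hd : v * ((w'⁻¹ : A⟦X⟧ˣ) : A⟦X⟧) = 1 := by
    apply derivative.ext
    · rw [Derivation.leibniz, derivative_inv, Derivation.map_one_eq_zero]
      simp only [smul_eq_mul]
      refine (unit_of hu).mul_left_cancel ?_
      rw [mul_zero]
      have e : (w' : A⟦X⟧) * ((w'⁻¹ : A⟦X⟧ˣ) : A⟦X⟧) = 1 := Units.mul_inv w'
      linear_combination ((w'⁻¹ : A⟦X⟧ˣ) : A⟦X⟧) * h1 -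
        v * ((w'⁻¹ : A⟦X⟧ˣ) : A⟦X⟧) ^ 2 * h2 - c * v * ((w'⁻¹ : A⟦X⟧ˣ) : A⟦X⟧) * e
    · rw [map_mul, hv, hinv, one_mul, map_one]
  rw [← mul_one v, ← Units.inv_mul w', ← mul_assoc, hd, one_mul]

theorem eq_seriesPow [IsAddTorsionFree A] {u w : A⟦X⟧} (hu : constantCoeff u = 1)
    (hw : constantCoeff w = 1) {a : f}
    (h : u * derivative A w = a • (w * derivative A u)) : w = seriesPow u a := by
  refine eq_of_mul_derivative_eq (c := a • derivative A u) hu hw (constantCoeff_seriesPow hu a) ?_ ?_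
  · rw [h, smul_mul_assoc, mul_comm]
  · rw [mul_derivative_seriesPow hu, smul_mul_assoc, mul_comm]

theorem mul_seriesPow [IsAddTorsionFree A] {u v : A⟦X⟧} (hu : constantCoeff u = 1)
    (hv : constantCoeff v = 1) (a : f) :
    seriesPow (u * v) a = seriesPow u a * seriesPow v a := by
  refine (eq_seriesPow (by simp [hu, hv]) (by simp [hu, hv]) ?_).symm
  have h1 := mul_derivative_seriesPow hu a
  have h2 := mul_derivative_seriesPow hv a
  simp only [Derivation.leibniz, smul_eq_mul] at *
  rw [Algebra.smul_def] at *
  linear_combination v * seriesPow v a * h1 + u * seriesPow u a * h2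

theorem seriesPow_seriesPow [IsAddTorsionFree A] {u : A⟦X⟧} (hu : constantCoeff u = 1) (a b : f) :
    seriesPow (seriesPow u a) b = seriesPow u (a * b) := by
  have hc := constantCoeff_seriesPow hu a
  refine eq_seriesPow hu (constantCoeff_seriesPow hc b) ?_
  have h1 := mul_derivative_seriesPow hu a
  have h2 := mul_derivative_seriesPow hc b
  refine (isUnit_iff_constantCoeff.2 (hc ▸ isUnit_one)).mul_left_cancel ?_
  rw [Algebra.smul_def] at *
  rw [map_mul]
  linear_combination u * h2 +
    algebraMap f A⟦X⟧ b * seriesPow (seriesPow u a) b * h1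

theorem subst_seriesPow {u γ : f⟦X⟧} (hu : constantCoeff u = 1) (hγ : constantCoeff γ = 0)
    (a : f) : (seriesPow u a).subst γ = seriesPow (u.subst γ) a := by
  have h := HasSubst.of_constantCoeff_zero' hγ
  have hc : ∀ v : f⟦X⟧, constantCoeff (v.subst γ) = constantCoeff v := fun v => by
    rw [← coeff_zero_eq_constantCoeff_apply, coeff_subst_eq_sum hγ v zero_lt_one]
    simp
  refine eq_seriesPow (by rw [hc, hu]) (by rw [hc, constantCoeff_seriesPow hu]) ?_
  have key := congrArg (subst γ) (mul_derivative_seriesPow hu a)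
  rw [subst_mul h, subst_smul h, subst_mul h] at key
  rw [derivative_subst h, derivative_subst h, ← mul_assoc, key, smul_mul_assoc, mul_assoc]

theorem rescale_seriesPow {u : A⟦X⟧} (hu : constantCoeff u = 1) (a : f) (c : A) :
    rescale c (seriesPow u a) = seriesPow (rescale c u) a := by
  ext n
  rw [coeff_rescale, coeff_seriesPow hu,
    coeff_seriesPow (by rw [constantCoeff_rescale_apply, hu]), Finset.mul_sum]
  refine Finset.sum_congr rfl fun i _ => ?_
  have e : rescale c u - 1 = rescale c (u - 1) := by rw [map_sub, map_one]
  rw [e, ← map_pow, coeff_rescale, mul_smul_comm]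

theorem dvd_seriesPow_sub_one {u : A⟦X⟧} (hu : constantCoeff u = 1) {n : ℕ}
    (h : (X : A⟦X⟧) ^ n ∣ u - 1) (a : f) : (X : A⟦X⟧) ^ n ∣ seriesPow u a - 1 := by
  rw [X_pow_dvd_iff]
  intro j hj
  rw [map_sub, coeff_seriesPow hu, Finset.sum_range_succ']
  have : ∀ r, coeff j ((u - 1) ^ (r + 1)) = 0 := fun r =>
    X_pow_dvd_iff.1 (h.trans (dvd_pow_self _ r.succ_ne_zero)) j hj
  simp [this]

theorem seriesPow_one_add_mul (w : A⟦X⟧) (hw : constantCoeff w = 0) (a : f) :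
    ∃ R, seriesPow (1 + w) a = 1 + a • w + w ^ 2 * R := by
  obtain ⟨B, hB⟩ : ∃ B : A⟦X⟧, binomialSeries A a = 1 + a • X + X ^ 2 * B := by
    refine ⟨PowerSeries.mk fun n => coeff (n + 2) (binomialSeries A a), ?_⟩
    ext n
    rcases n with _ | _ | n
    · simp
    · simp [coeff_X_pow_mul', coeff_one]
    · rw [map_add, map_add, coeff_X_pow_mul', if_pos (by omega), coeff_mk]
      simp [coeff_one, coeff_X]
  have h := HasSubst.of_constantCoeff_zero' hw
  have h1 : subst w (1 : A⟦X⟧) = (1 : A⟦X⟧) := by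
    rw [← coe_substAlgHom h, map_one]
  refine ⟨B.subst w, ?_⟩
  rw [seriesPow, add_sub_cancel_left, hB, subst_add h, subst_add h, subst_mul h, subst_pow h,
    subst_X h, h1, algebra_compatible_smul A a X, subst_smul h, subst_X h,
    ← algebra_compatible_smul A]

end SeriesPow

/-! ### Automorphisms of f((t)) as coordinate changes -/

section Automorphisms

variable {f : Type*} [Field f]

theorem mem_range_ofPowerSeries_of_order_eq_zero {x : LaurentSeries f} (hx : x.order = 0) :
    ∃ u : f⟦X⟧, x = HahnSeries.ofPowerSeries ℤ f u := by
  refine ⟨x.powerSeriesPart, ?_⟩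
  rw [LaurentSeries.ofPowerSeries_powerSeriesPart, hx, neg_zero]
  exact (one_mul x).symm

theorem regularPart_ofPowerSeries (u : f⟦X⟧) :
    regularPart (HahnSeries.ofPowerSeries ℤ f u) = u := by
  ext n
  rw [regularPart, coeff_mk, LaurentSeries.coeff_coe_powerSeries]

theorem ofPowerSeries_C (c : f) :
    HahnSeries.ofPowerSeries ℤ f (C c) = algebraMap f (LaurentSeries f) c :=
  rfl

/-- Automorphisms of `f((t))` over `f` preserve `f[[t]]`, because series with constant term `1` are
`p`-th powers for every `p > 0`. -/
theorem algEquiv_mem_range_ofPowerSeries [CharZero f]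
    (g : LaurentSeries f ≃ₐ[f] LaurentSeries f) (h : f⟦X⟧) :
    ∃ u : f⟦X⟧, g (HahnSeries.ofPowerSeries ℤ f h) = HahnSeries.ofPowerSeries ℤ f u := by
  have unit_case : ∀ u : f⟦X⟧, constantCoeff u = 1 →
      ∃ v : f⟦X⟧, g (HahnSeries.ofPowerSeries ℤ f u) = HahnSeries.ofPowerSeries ℤ f v := by
    intro u hu
    apply mem_range_ofPowerSeries_of_order_eq_zero
    set d := (g (HahnSeries.ofPowerSeries ℤ f u)).order with hd
    -- A p-th root of u makes the order d divisible by p, and p > |d| then forces d = 0.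
    set p := d.natAbs + 1 with hp
    have hroot : seriesPow u ((p : f)⁻¹) ^ p = u := by
      rw [← seriesPow_natCast (f := f) (constantCoeff_seriesPow hu _), seriesPow_seriesPow hu,
        inv_mul_cancel₀ (Nat.cast_ne_zero.2 (by omega)), ← Nat.cast_one, seriesPow_natCast hu,
        pow_one]
    have hdvd : (p : ℤ) ∣ d := by
      rw [hd, ← hroot, map_pow, map_pow, HahnSeries.order_pow, nsmul_eq_mul]
      exact dvd_mul_right _ _
    exact Int.eq_zero_of_dvd_of_natAbs_lt_natAbs hdvd (by omega)
  obtain ⟨v, hv⟩ := unit_case (h - C (constantCoeff h) + 1) (by simp)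
  refine ⟨v + C (constantCoeff h - 1), ?_⟩
  have e : h = h - C (constantCoeff h) + 1 + C (constantCoeff h - 1) := by
    rw [map_sub, map_one]; ring
  rw [map_add, ← hv, ofPowerSeries_C, ← g.commutes (constantCoeff h - 1), ← map_add,
    ← ofPowerSeries_C, ← map_add, ← e]

/-- Continuity is not assumed but automatic: writing h as a polynomial plus t^(j+1) s, the image of
s is again a power series, so the remainder maps into multiples of γ^(j+1) and does not affect the
coefficient of t^j. -/
theorem algEquiv_ofPowerSeries_eq_subst [CharZero f]
    {g : LaurentSeries f ≃ₐ[f] LaurentSeries f} {γ : f⟦X⟧} (hγ : constantCoeff γ = 0)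
    (hg : g (tL f) = HahnSeries.ofPowerSeries ℤ f γ) (h : f⟦X⟧) :
    g (HahnSeries.ofPowerSeries ℤ f h) = HahnSeries.ofPowerSeries ℤ f (h.subst γ) := by
  have hs := HasSubst.of_constantCoeff_zero' hγ
  have hpoly : ∀ p : Polynomial f, g (HahnSeries.ofPowerSeries ℤ f (p : f⟦X⟧)) =
      HahnSeries.ofPowerSeries ℤ f ((p : f⟦X⟧).subst γ) := by
    intro p
    have hC : ∀ c : f, (C c : f⟦X⟧).subst γ = C c := fun c =>
      subst_C c
    have hX : g (HahnSeries.ofPowerSeries ℤ f X) = HahnSeries.ofPowerSeries ℤ f γ := hg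
    induction p using Polynomial.induction_on with
    | add p q hp hq =>
      rw [Polynomial.coe_add, map_add, map_add, hp, hq, subst_add hs, map_add]
    | C c => rw [Polynomial.coe_C, hC, ofPowerSeries_C, g.commutes]
    | monomial n c _ =>
      rw [Polynomial.coe_mul, Polynomial.coe_pow, Polynomial.coe_X, Polynomial.coe_C,
        subst_mul hs, subst_pow hs, subst_X hs, hC, map_mul, map_mul, map_mul, map_pow, map_pow,
        map_pow, hX, ofPowerSeries_C, g.commutes]
  obtain ⟨u, hu⟩ := algEquiv_mem_range_ofPowerSeries g h
  rw [hu]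
  congr 1
  ext j
  have e := eq_X_pow_mul_shift_add_trunc (j + 1) h
  set s : f⟦X⟧ := PowerSeries.mk fun i => coeff (i + (j + 1)) h
  obtain ⟨v, hv⟩ := algEquiv_mem_range_ofPowerSeries g s
  have hX : HahnSeries.ofPowerSeries ℤ f X = tL f := rfl
  have e1 : u = γ ^ (j + 1) * v + ((trunc (j + 1) h : Polynomial f) : f⟦X⟧).subst γ := by
    apply HahnSeries.ofPowerSeries_injective (Γ := ℤ)
    rw [← hu, e, map_add, map_add, hpoly, map_mul, map_mul, map_pow, map_pow, hX, hg, hv, map_add,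
      map_mul, map_pow, ← e]
  have e2 : h.subst γ = γ ^ (j + 1) * s.subst γ +
      ((trunc (j + 1) h : Polynomial f) : f⟦X⟧).subst γ := by
    rw [← subst_X (R := f) hs, ← subst_pow hs, subst_X hs, ← subst_mul hs, ← subst_add hs, ← e]
  have hdvd : (X : f⟦X⟧) ^ (j + 1) ∣ γ ^ (j + 1) := pow_dvd_pow_of_dvd (X_dvd_iff.2 hγ) _
  rw [e1, e2, map_add, map_add, X_pow_dvd_iff.1 (hdvd.mul_right v) j (by omega),
    X_pow_dvd_iff.1 (hdvd.mul_right _) j (by omega)]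

theorem exists_algEquiv_of_subst {γ : f⟦X⟧} (hγ : constantCoeff γ = 0)
    (hγ1 : coeff 1 γ = 1) :
    ∃ g : LaurentSeries f ≃ₐ[f] LaurentSeries f, g (tL f) = HahnSeries.ofPowerSeries ℤ f γ := by
  have hu : IsUnit (coeff 1 γ) := hγ1 ▸ isUnit_one
  have hs := HasSubst.of_constantCoeff_zero' hγ
  have hs' := HasSubst.of_constantCoeff_zero' (constantCoeff_substInvOfIsUnit γ hu)
  let φ : f⟦X⟧ ≃ₐ[f] f⟦X⟧ := AlgEquiv.ofAlgHom (substAlgHom hs) (substAlgHom hs')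
    (by
      ext1 x
      rw [AlgHom.comp_apply, coe_substAlgHom, coe_substAlgHom, subst_comp_subst_apply hs' hs,
        subst_substInvOfIsUnit_left γ hγ hu, X_subst, AlgHom.id_apply])
    (by
      ext1 x
      rw [AlgHom.comp_apply, coe_substAlgHom, coe_substAlgHom, subst_comp_subst_apply hs hs',
        subst_substInvOfIsUnit_right γ hγ hu, X_subst, AlgHom.id_apply])
  have : @IsScalarTower f f (LaurentSeries f) _ Algebra.toSMul Algebra.toSMul :=
    IsScalarTower.of_algebraMap_eq fun _ => rfl
  have : @IsScalarTower f f⟦X⟧ (LaurentSeries f) _ _ Algebra.toSMul :=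
    IsScalarTower.of_algebraMap_eq fun c => (ofPowerSeries_C c).symm
  refine ⟨IsFractionRing.fieldEquivOfAlgEquiv f (LaurentSeries f) (LaurentSeries f) φ, ?_⟩
  refine (IsFractionRing.fieldEquivOfAlgEquiv_algebraMap f (LaurentSeries f) (LaurentSeries f) φ
    X).trans ?_
  change HahnSeries.ofPowerSeries ℤ f (substAlgHom hs X) = _
  rw [substAlgHom_X]

end Automorphisms

/-! ### The group action through coordinate changes t ↦ t u -/

section SubstDensity

variable {f : Type*} [Field f] [CharZero f]

/-- The coefficient series of `g(h) g(t) ^ μ (d g(t)) ^ (-λ)` for the coordinate change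
`g(t) = t u`. -/
noncomputable def substDensity (lam mu : f) (u h : f⟦X⟧) : f⟦X⟧ :=
  h.subst (X * u) * seriesPow u mu * seriesPow (derivative f (X * u)) (-lam)

theorem groupDensity_eq_substDensity (lam mu : f) {g : LaurentSeries f ≃ₐ[f] LaurentSeries f}
    {u : f⟦X⟧} (hg : g (tL f) = HahnSeries.ofPowerSeries ℤ f (X * u)) (h : f⟦X⟧) :
    groupDensity lam mu g h = substDensity lam mu u h := by
  have ht : tL f ≠ 0 := fun h0 =>
    X_ne_zero (HahnSeries.ofPowerSeries_injective (Γ := ℤ) (h0.trans (map_zero _).symm))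
  have hX : HahnSeries.ofPowerSeries ℤ f X = tL f := rfl
  rw [groupDensity, algEquiv_ofPowerSeries_eq_subst (by simp) hg, hg, regularPart_ofPowerSeries,
    regularPart_ofPowerSeries, map_mul, hX, mul_div_cancel_left₀ _ ht, regularPart_ofPowerSeries,
    substDensity]

theorem mem_groupInvariants_iff (lam mu : f) {n : ℕ} (hn : 0 < n) (P : MvPolynomial ℕ f) :
    P ∈ groupInvariants lam mu n ↔
      ∀ r h : f⟦X⟧, polyEval (substDensity lam mu (1 + X ^ n * r) h) P = polyEval h P := by
  have e : ∀ r : f⟦X⟧, tL f + HahnSeries.ofPowerSeries ℤ f (X ^ (n + 1) * r) =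
      HahnSeries.ofPowerSeries ℤ f (X * (1 + X ^ n * r)) := fun r => by
    rw [mul_add, mul_one, map_add, pow_succ', mul_assoc]
    rfl
  constructor
  · intro hP r h
    obtain ⟨g, hg⟩ := exists_algEquiv_of_subst (γ := X * (1 + X ^ n * r)) (by simp) (by
      rw [show (1 : ℕ) = 0 + 1 from rfl, coeff_succ_X_mul]
      simp [hn.ne'])
    rw [← groupDensity_eq_substDensity lam mu hg]
    exact hP g ⟨r, hg.trans (e r).symm⟩ h
  · rintro hP g ⟨r, hr⟩ h
    rw [groupDensity_eq_substDensity lam mu (hr.trans (e r))]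
    exact hP r h

end SubstDensity

/-! ### Truncated substitutions -/

section Truncation

variable {R : Type*} [CommRing R]

theorem coeff_subst_mul_eq_sum {γ : R⟦X⟧} (hγ : constantCoeff γ = 0) (F W : R⟦X⟧) (n : ℕ) :
    coeff n (F.subst γ * W) =
      ∑ i ∈ Finset.range (n + 1), coeff i F * coeff n (γ ^ i * W) := by
  have h : (X : R⟦X⟧) ^ (n + 1) ∣
      F.subst γ - ∑ i ∈ Finset.range (n + 1), C (coeff i F) * γ ^ i := by
    rw [X_pow_dvd_iff]
    intro j hj
    rw [map_sub, coeff_subst_eq_sum hγ F hj, map_sum, sub_eq_zero]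
    exact Finset.sum_congr rfl fun i _ => by rw [coeff_C_mul, smul_eq_mul]
  have h' := X_pow_dvd_iff.1 (h.mul_right W) n n.lt_succ_self
  rw [sub_mul, map_sub, sub_eq_zero, Finset.sum_mul, map_sum] at h'
  rw [h']
  exact Finset.sum_congr rfl fun i _ => by rw [mul_assoc, coeff_C_mul]

theorem dvd_subst_sub (n : ℕ) (r h : R⟦X⟧) :
    (X : R⟦X⟧) ^ (n + 1) ∣ h.subst (X * (1 + X ^ n * r)) - h := by
  rw [X_pow_dvd_iff]
  intro j hj
  have hX : h.subst (X : R⟦X⟧) = h := X_subst h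
  nth_rewrite 2 [← hX]
  rw [map_sub, coeff_subst_eq_sum (by simp) h j.lt_succ_self,
    coeff_subst_eq_sum (by simp) h j.lt_succ_self, ← Finset.sum_sub_distrib]
  refine Finset.sum_eq_zero fun i _ => ?_
  have hd : (X : R⟦X⟧) ^ (n + 1) ∣ (X * (1 + X ^ n * r)) ^ i - X ^ i :=
    Dvd.dvd.trans ⟨r, by ring⟩ (sub_dvd_pow_sub_pow _ _ i)
  rw [← smul_sub, ← map_sub, X_pow_dvd_iff.1 hd j hj, smul_zero]

theorem constantCoeff_one_add_X_pow_mul {n : ℕ} (hn : 0 < n) (r : R⟦X⟧) :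
    constantCoeff (1 + X ^ n * r) = 1 := by simp [hn.ne']

theorem derivative_X_mul (u : R⟦X⟧) : derivative R (X * u) = u + X * derivative R u := by
  rw [Derivation.leibniz, derivative_X, smul_eq_mul, smul_eq_mul, mul_one, add_comm]

theorem constantCoeff_derivative_X_mul {u : R⟦X⟧} (hu : constantCoeff u = 1) :
    constantCoeff (derivative R (X * u)) = 1 := by
  rw [derivative_X_mul]; simp [hu]

end Truncation

/-! ### The action on low coefficients, and its linearity -/

section LowOrder

variable {f : Type*} [Field f] [CharZero f]

theorem dvd_substDensity_sub (lam mu : f) {n : ℕ} (hn : 0 < n) (r h : f⟦X⟧) :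
    (X : f⟦X⟧) ^ n ∣ substDensity lam mu (1 + X ^ n * r) h - h := by
  have hu := constantCoeff_one_add_X_pow_mul hn r
  have h1 : (X : f⟦X⟧) ^ n ∣ h.subst (X * (1 + X ^ n * r)) - h :=
    (pow_dvd_pow _ n.le_succ).trans (dvd_subst_sub n r h)
  have h2 : (X : f⟦X⟧) ^ n ∣ seriesPow (1 + X ^ n * r) mu - 1 :=
    dvd_seriesPow_sub_one hu ⟨r, by ring⟩ mu
  have h3 : (X : f⟦X⟧) ^ n ∣ seriesPow (derivative f (X * (1 + X ^ n * r))) (-lam) - 1 := by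
    refine dvd_seriesPow_sub_one (constantCoeff_derivative_X_mul hu) ?_ _
    have e : X * (1 + X ^ n * r) = X + X ^ (n + 1) * r := by ring
    rw [e, map_add, derivative_X, add_sub_cancel_left, Derivation.leibniz, Derivation.leibniz_pow]
    simp only [smul_eq_mul, nsmul_eq_mul, Nat.add_sub_cancel]
    exact ⟨X * derivative f r + r * ((n + 1 : ℕ) : f⟦X⟧), by rw [derivative_X]; ring⟩
  obtain ⟨a, ha⟩ := h1
  obtain ⟨b, hb⟩ := h2
  obtain ⟨c, hc⟩ := h3
  rw [substDensity, eq_add_of_sub_eq ha, eq_add_of_sub_eq hb, eq_add_of_sub_eq hc]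
  exact ⟨(X ^ n * b + 1) * (X ^ n * c + 1) * a + h * (b * (X ^ n * c + 1) + c), by ring⟩

theorem coeff_substDensity_of_lt (lam mu : f) {n : ℕ} (hn : 0 < n) (r h : f⟦X⟧) {j : ℕ}
    (hj : j < n) : coeff j (substDensity lam mu (1 + X ^ n * r) h) = coeff j h := by
  have := X_pow_dvd_iff.1 (dvd_substDensity_sub lam mu hn r h) j hj
  rwa [map_sub, sub_eq_zero] at this

theorem coeff_substDensity_zero {n : ℕ} (hn : 0 < n) (r h : f⟦X⟧) {j : ℕ}
    (hj : j < n + 1) : coeff j (substDensity (0 : f) 0 (1 + X ^ n * r) h) = coeff j h := by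
  have hu := constantCoeff_one_add_X_pow_mul hn r
  have := X_pow_dvd_iff.1 (dvd_subst_sub n r h) j hj
  rw [substDensity, neg_zero, seriesPow_zero hu,
    seriesPow_zero (constantCoeff_derivative_X_mul hu), mul_one, mul_one]
  rwa [map_sub, sub_eq_zero] at this

theorem substDensity_add (lam mu : f) {u : f⟦X⟧} (h k : f⟦X⟧) :
    substDensity lam mu u (h + k) = substDensity lam mu u h + substDensity lam mu u k := by
  rw [substDensity, subst_add (HasSubst.of_constantCoeff_zero' (by simp)), add_mul, add_mul]
  rfl

theorem substDensity_smul (lam mu : f) {u : f⟦X⟧} (c : f) (h : f⟦X⟧) :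
    substDensity lam mu u (c • h) = c • substDensity lam mu u h := by
  rw [substDensity, subst_smul (HasSubst.of_constantCoeff_zero' (by simp)), smul_mul_assoc,
    smul_mul_assoc]
  rfl

end LowOrder

/-! ### Coordinate invariance of the fractional residue -/

section Residue

variable {f : Type*} [Field f] [CharZero f]

/-- For p > 0 the form (tu)^(-p-1) d(tu) is exact, so it has no residue. Concretely, p times the
series is p v^p - t (v^p)', whose coefficient of t^p vanishes. -/
theorem coeff_pow_inverse_residue {u v : f⟦X⟧} (huv : v * u = 1)
    {p : ℕ} (hp : 0 < p) : coeff p (v ^ p + X * derivative f u * v ^ (p + 1)) = 0 := by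
  have hd : derivative f v = -(v ^ 2 * derivative f u) := by
    have h := congrArg (derivative f) huv
    rw [Derivation.leibniz, Derivation.map_one_eq_zero, smul_eq_mul, smul_eq_mul] at h
    linear_combination v * h - derivative f v * huv
  have hp0 : (p : f) ≠ 0 := Nat.cast_ne_zero.2 hp.ne'
  have key : (p : f⟦X⟧) * (v ^ p + X * derivative f u * v ^ (p + 1)) =
      (p : f⟦X⟧) * v ^ p - X * derivative f (v ^ p) := by
    obtain ⟨q, rfl⟩ := Nat.exists_eq_add_of_lt hp
    rw [Derivation.leibniz_pow, hd]
    simp only [smul_eq_mul, nsmul_eq_mul, Nat.add_sub_cancel]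
    ring
  have hC : (p : f⟦X⟧) = C (p : f) := (map_natCast C p).symm
  apply mul_left_cancel₀ hp0
  rw [← coeff_C_mul, ← hC, key, hC, map_sub, coeff_C_mul, mul_zero]
  obtain ⟨q, rfl⟩ := Nat.exists_eq_add_of_lt hp
  rw [coeff_succ_X_mul, coeff_derivative]
  push_cast
  ring

/-- Invariance of the residue of `w t ^ (-N - 1) dt` under the coordinate change `t ↦ t u`. -/
theorem coeff_subst_mul_residue {u v : f⟦X⟧} (huv : v * u = 1) (N : ℕ) (w : f⟦X⟧) :
    coeff N (w.subst (X * u) * (derivative f (X * u) * v ^ (N + 1))) = coeff N w := by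
  rw [coeff_subst_mul_eq_sum (by simp), Finset.sum_range_succ]
  -- Splitting w into monomials leaves an exact form for each i < N; only i = N contributes a
  -- residue.
  have e : ∀ i p, i + p = N → (X * u) ^ i * (derivative f (X * u) * v ^ (N + 1)) =
      X ^ i * (v ^ p + X * derivative f u * v ^ (p + 1)) := by
    rintro i p rfl
    have h1 : v ^ i * u ^ i = 1 := by rw [← mul_pow, huv, one_pow]
    rw [derivative_X_mul, mul_pow]
    linear_combination (X ^ i * (v ^ (p + 1) * (u + X * derivative f u))) * h1 +
      X ^ i * v ^ p * huv
  rw [Finset.sum_eq_zero, zero_add, e N 0 (add_zero N)]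
  · rw [coeff_X_pow_mul', if_pos le_rfl, Nat.sub_self]
    simp
  · intro i hi
    have hi' := Finset.mem_range.1 hi
    rw [e i (N - i) (by omega), coeff_X_pow_mul', if_pos hi'.le,
      coeff_pow_inverse_residue huv (by omega), mul_zero]

/-- Raising to the power -1/λ turns the factor u^μ into u^(-N-1) and the factor ((tu)')^(-λ) into
(tu)', so the density becomes a 1-form and the claim is invariance of its residue. -/
theorem coeff_seriesPow_substDensity {lam mu : f} (hlam : lam ≠ 0) {N : ℕ}
    (hmu : mu = ((N : f) + 1) * lam) {u h : f⟦X⟧} (hu : constantCoeff u = 1)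
    (hh : constantCoeff h = 1) :
    coeff N (seriesPow (substDensity lam mu u h) (-1 / lam)) =
      coeff N (seriesPow h (-1 / lam)) := by
  have hγ : constantCoeff (X * u) = 0 := by simp
  have hd := constantCoeff_derivative_X_mul hu
  have hs : constantCoeff (h.subst (X * u)) = 1 := by
    rw [← coeff_zero_eq_constantCoeff_apply, coeff_subst_eq_sum hγ h zero_lt_one]
    simp [hh]
  have hp := constantCoeff_seriesPow hu mu
  have hv := constantCoeff_seriesPow hu (-1 : f)
  have e1 : mu * (-1 / lam) = (-1 : f) * ((N + 1 : ℕ) : f) := by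
    rw [hmu]; push_cast; field_simp
  have e2 : -lam * (-1 / lam) = ((1 : ℕ) : f) := by
    push_cast; field_simp
  rw [substDensity, mul_seriesPow (by simp [hs, hp]) (constantCoeff_seriesPow hd _),
    mul_seriesPow hs hp, seriesPow_seriesPow hu, seriesPow_seriesPow hd, e1, e2,
    ← seriesPow_seriesPow hu, seriesPow_natCast hv, seriesPow_natCast hd, pow_one,
    ← subst_seriesPow hh hγ, mul_assoc, mul_comm (_ ^ _)]
  refine coeff_subst_mul_residue ?_ N _
  have := seriesPow_add hu (-1 : f) ((1 : ℕ) : f)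
  rw [seriesPow_natCast hu, pow_one, Nat.cast_one, neg_add_cancel, seriesPow_zero hu] at this
  exact this.symm

end Residue

/-! ### From the group to the Lie algebra -/

section Infinitesimal

variable {f : Type*} [Field f]

theorem lieDensity_X_pow (lam mu : f) (D : Derivation f f⟦X⟧ f⟦X⟧) {ρ : f⟦X⟧} (hD : D X = X * ρ)
    (i : ℕ) :
    lieDensity lam mu D (X ^ i) =
      X ^ i * (C ((i : f) + mu) * ρ - C lam * (ρ + X * derivative f ρ)) := by
  have hmk : (PowerSeries.mk fun j => coeff (j + 1) (X * ρ)) = ρ := by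
    ext j; rw [coeff_mk, coeff_succ_X_mul]
  have hpow : D (X ^ i) = (i : f⟦X⟧) * X ^ i * ρ := by
    rw [Derivation.leibniz_pow, hD, smul_eq_mul, nsmul_eq_mul]
    cases i with
    | zero => simp
    | succ i => rw [Nat.add_sub_cancel]; ring
  rw [lieDensity, LinearMap.add_apply, LinearMap.mulLeft_apply, Derivation.coeFn_coe, hpow, hD, hmk,
    derivative_X_mul, smul_eq_C_mul, smul_eq_C_mul, map_add, map_natCast]
  ring

theorem derivative_map {R S : Type*} [CommRing R] [CommRing S] (φ : R →+* S) (ρ : R⟦X⟧) :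
    derivative S (PowerSeries.map φ ρ) = PowerSeries.map φ (derivative R ρ) := by
  ext n
  simp [coeff_derivative]

variable [CharZero f] {A : Type*} [CommRing A] [Algebra f A]

/-- `g(t) ^ i (g(t) / t) ^ μ (g(t)') ^ (-λ)` for `g(t) = t u`. -/
noncomputable def basisSeries (lam mu : f) (u : A⟦X⟧) (i : ℕ) : A⟦X⟧ :=
  (X * u) ^ i * (seriesPow u mu * seriesPow (derivative A (X * u)) (-lam))

theorem map_basisSeries (lam mu : f) {B : Type*} [CommRing B] [Algebra f B] (φ : A →ₐ[f] B)
    {u : A⟦X⟧} (hu : constantCoeff u = 1) (i : ℕ) :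
    PowerSeries.map (φ : A →+* B) (basisSeries lam mu u i) =
      basisSeries lam mu (PowerSeries.map (φ : A →+* B) u) i := by
  rw [basisSeries, basisSeries, map_mul, map_mul, map_pow, map_seriesPow φ hu,
    map_seriesPow φ (constantCoeff_derivative_X_mul hu), ← derivative_map, map_mul, map_X]

theorem coeff_substDensity (lam mu : f) (u h : f⟦X⟧) (j : ℕ) :
    coeff j (substDensity lam mu u h) =
      ∑ i ∈ Finset.range (j + 1), coeff i h * coeff j (basisSeries lam mu u i) := by
  rw [substDensity, mul_assoc, coeff_subst_mul_eq_sum (by simp)]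
  rfl

/-- First-order expansion in T: each of the three powers contributes its exponent times its
increment, and the sum is the Lie derivative of t^i. -/
theorem basisSeries_one_add_mul (lam mu : f) (T : A) {ρ : A⟦X⟧} (hρ : constantCoeff ρ = 0)
    (i : ℕ) :
    ∃ R, basisSeries lam mu (1 + C T * ρ) i = X ^ i +
      C T * (X ^ i * (((i : f) + mu) • ρ - lam • (ρ + X * derivative A ρ))) + C (T ^ 2) * R := by
  have hw : constantCoeff (C T * ρ) = 0 := by rw [map_mul, hρ, mul_zero]
  have hw' : constantCoeff (C T * (ρ + X * derivative A ρ)) = 0 := by simp [hρ]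
  have hU' : derivative A (X * (1 + C T * ρ)) = 1 + C T * (ρ + X * derivative A ρ) := by
    rw [derivative_X_mul, map_add, Derivation.map_one_eq_zero, Derivation.leibniz, derivative_C]
    simp only [smul_eq_mul]
    ring
  obtain ⟨R₁, h₁⟩ := seriesPow_one_add_mul _ hw (i : f)
  obtain ⟨R₂, h₂⟩ := seriesPow_one_add_mul _ hw mu
  obtain ⟨R₃, h₃⟩ := seriesPow_one_add_mul _ hw' (-lam)
  rw [seriesPow_natCast (by rw [map_add, hw]; simp)] at h₁
  have mul_mod_sq : ∀ t a b a' b' : A⟦X⟧, (1 + t * a + t ^ 2 * b) * (1 + t * a' + t ^ 2 * b') =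
      1 + t * (a + a') +
        t ^ 2 * (b + b' + a * a' + t * (a * b' + a' * b) + t ^ 2 * (b * b')) := fun t a b a' b' => by
    ring
  rw [basisSeries, mul_pow, h₁, h₂, hU', h₃]
  simp only [← mul_smul_comm, mul_pow, mul_assoc, map_pow]
  rw [mul_mod_sq, mul_mod_sq]
  refine ⟨_, (mul_add _ _ _).trans (congrArg₂ _ ?_ (mul_left_comm _ _ _))⟩
  rw [add_smul, neg_smul]
  ring

/-- Along the one-parameter family of coordinate changes `t ↦ t (1 + s ρ)`, the density moves
polynomially in `s`, with derivative given by the Lie derivative along `t ρ d/dt`. -/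
theorem exists_polynomial_coeff_substDensity (lam mu : f) {D : Derivation f f⟦X⟧ f⟦X⟧} {ρ : f⟦X⟧}
    (hD : D X = X * ρ) (hρ : constantCoeff ρ = 0) (h : f⟦X⟧) (j : ℕ) :
    ∃ q : Polynomial f,
      (∀ c, q.eval c = coeff j (substDensity lam mu (1 + C c * ρ) h)) ∧ q.coeff 0 = coeff j h ∧
      q.coeff 1 =
        ∑ i ∈ Finset.range (j + 1), coeff j (lieDensity lam mu D (X ^ i)) * coeff i h := by
  -- The parameter s is made the indeterminate of f[s]; specialising s to c then recovers each
  -- member of the family.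
  set ι : f →+* Polynomial f := (Algebra.ofId f (Polynomial f) : f →+* Polynomial f) with hι
  set U : (Polynomial f)⟦X⟧ := 1 + C Polynomial.X * PowerSeries.map ι ρ with hU
  have hιρ : constantCoeff (PowerSeries.map ι ρ) = 0 := by
    rw [constantCoeff_map_apply, hρ, map_zero]
  have hUc : constantCoeff U = 1 := by rw [hU, map_add, map_mul, hιρ]; simp
  have hexp : ∀ i, ∃ r : Polynomial f, coeff j (basisSeries lam mu U i) =
      Polynomial.C (coeff j (X ^ i : f⟦X⟧)) +
        Polynomial.X * Polynomial.C (coeff j (lieDensity lam mu D (X ^ i))) +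
        Polynomial.X ^ 2 * r := by
    intro i
    obtain ⟨R, hR⟩ := basisSeries_one_add_mul lam mu (Polynomial.X : Polynomial f) hιρ i
    have e : X ^ i * (((i : f) + mu) • PowerSeries.map ι ρ -
        lam • (PowerSeries.map ι ρ + X * derivative (Polynomial f) (PowerSeries.map ι ρ))) =
        PowerSeries.map ι (lieDensity lam mu D (X ^ i)) := by
      have hsm : ∀ (a : f) (w : f⟦X⟧), a • PowerSeries.map ι w = PowerSeries.map ι (C a * w) := by
        intro a w
        ext1 n
        rw [coeff_smul, coeff_map, coeff_map, coeff_C_mul, map_mul, Algebra.smul_def]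
        rfl
      rw [lieDensity_X_pow lam mu D hD, derivative_map, map_mul, map_sub, ← hsm, ← hsm, map_add,
        map_mul, map_pow, map_X]
    refine ⟨coeff j R, ?_⟩
    rw [hU, hR, map_add, map_add, coeff_C_mul, coeff_C_mul, e, coeff_map,
      ← map_X ι, ← map_pow, coeff_map]
    rfl
  refine ⟨∑ i ∈ Finset.range (j + 1), Polynomial.C (coeff i h) * coeff j (basisSeries lam mu U i),
    fun c => ?_, ?_, ?_⟩
  · have hmap : PowerSeries.map ((Polynomial.aeval c : Polynomial f →ₐ[f] f) :
        Polynomial f →+* f) U = 1 + C c * ρ := by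
      rw [hU, map_add, map_mul, map_one, map_C]
      congr 2
      · simp
      · ext n; simp [hι]
    rw [coeff_substDensity, Polynomial.eval_finsetSum]
    refine Finset.sum_congr rfl fun i _ => ?_
    rw [Polynomial.eval_mul, Polynomial.eval_C, ← hmap, ← map_basisSeries _ _ _ hUc, coeff_map]
    rfl
  · rw [Polynomial.finsetSum_coeff, Finset.sum_eq_single_of_mem j (by simp)]
    · obtain ⟨r, hr⟩ := hexp j
      rw [hr, Polynomial.coeff_C_mul]
      simp [Polynomial.mul_coeff_zero]
    · intro i _ hij
      obtain ⟨r, hr⟩ := hexp i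
      rw [hr, Polynomial.coeff_C_mul]
      simp [Polynomial.mul_coeff_zero, coeff_X_pow, hij.symm]
  · rw [Polynomial.finsetSum_coeff]
    refine Finset.sum_congr rfl fun i _ => ?_
    obtain ⟨r, hr⟩ := hexp i
    rw [hr, Polynomial.coeff_C_mul]
    simp only [Polynomial.coeff_add, Polynomial.coeff_C_succ, Polynomial.coeff_X_mul,
      Polynomial.coeff_C_zero, sq, mul_assoc, Polynomial.mul_coeff_zero, Polynomial.coeff_X_zero]
    ring

/-- Along t ↦ t(1 + cρ) the value of P is a polynomial in c. Invariance makes it constant, and its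
linear coefficient is minus the value of the Lie derivative of P, the sign coming from the dual
representation. -/
theorem groupInvariants_le_lieInvariants (lam mu : f) {n : ℕ} (hn : 0 < n) :
    groupInvariants lam mu n ≤ lieInvariants lam mu n := by
  intro P hP D hD
  rw [mem_groupInvariants_iff lam mu hn] at hP
  obtain ⟨r, hr⟩ := hD
  have hDX : D X = X * (X ^ n * r) := by rw [hr]; ring
  have hρ : constantCoeff (X ^ n * r) = 0 := by simp [hn.ne']
  refine MvPolynomial.funext fun x => ?_
  set h : f⟦X⟧ := PowerSeries.mk x
  choose q hq using exists_polynomial_coeff_substDensity lam mu hDX hρ h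
  have heval : ∀ c, (MvPolynomial.aeval q P).eval c = polyEval h P := by
    intro c
    rw [← hP (C c * r) h, show X ^ n * (C c * r) = C c * (X ^ n * r) by ring, polyEval,
      ← Polynomial.coe_evalRingHom, MvPolynomial.aeval_def, MvPolynomial.aeval_def,
      MvPolynomial.hom_eval₂]
    congr 1
    · ext; simp
    · ext j; exact (hq j).1 c
  have hcoeff : ∀ Q : MvPolynomial ℕ f, (MvPolynomial.aeval q Q).coeff 0 = polyEval h Q ∧
      (MvPolynomial.aeval q Q).coeff 1 = -polyEval h (liePoly lam mu D Q) := by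
    intro Q
    induction Q using MvPolynomial.induction_on with
    | C a =>
      have hc : (MvPolynomial.C a : MvPolynomial ℕ f) = algebraMap f _ a := rfl
      rw [hc, AlgHom.commutes, AlgHom.commutes, Derivation.map_algebraMap]
      simp
    | add p q hp hq =>
      simp only [map_add, Polynomial.coeff_add, hp.1, hp.2, hq.1, hq.2]
      exact ⟨trivial, by ring⟩
    | mul_X p j hp =>
      have hX : polyEval h (liePoly lam mu D (MvPolynomial.X j)) = -(q j).coeff 1 := by
        rw [liePoly, MvPolynomial.mkDerivation_X, (hq j).2.2, map_neg, map_sum]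
        simp [polyEval]
      have hX' : polyEval h (MvPolynomial.X j) = (q j).coeff 0 := by
        rw [(hq j).2.1]; simp [polyEval]
      rw [Derivation.leibniz, smul_eq_mul, smul_eq_mul, map_mul, map_mul, map_add, map_mul, map_mul,
        hX, hX', MvPolynomial.aeval_X, Polynomial.mul_coeff_zero, Polynomial.mul_coeff_one, hp.1,
        hp.2]
      exact ⟨rfl, by ring⟩
  have hconst : MvPolynomial.aeval q P = Polynomial.C (polyEval h P) :=
    Polynomial.funext fun c => by rw [heval, Polynomial.eval_C]
  have key := (hcoeff P).2
  rw [hconst, Polynomial.coeff_C_succ, eq_comm, neg_eq_zero] at key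
  rw [map_zero, ← key, polyEval, MvPolynomial.aeval_def, MvPolynomial.eval]
  simp [h, MvPolynomial.eval₂Hom]

end Infinitesimal

/-! ### Reduction to densities with nonzero leading coefficient -/

section Lines

variable {f : Type*} [Field f]

theorem exists_polynomial_polyEval (h k : f⟦X⟧) (P : MvPolynomial ℕ f) :
    ∃ p : Polynomial f, ∀ c, p.eval c = polyEval (h + c • k) P := by
  refine ⟨MvPolynomial.aeval (fun j => Polynomial.C (coeff j h) +
    Polynomial.X * Polynomial.C (coeff j k)) P, fun c => ?_⟩
  rw [polyEval, ← Polynomial.coe_evalRingHom, MvPolynomial.aeval_def, MvPolynomial.aeval_def,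
    MvPolynomial.hom_eval₂]
  congr 1
  · ext; simp
  · ext j; simp; ring

/-- To check that a polynomial is an invariant, it suffices to look at densities with a nonzero
leading coefficient. -/
theorem polyEval_eq_of_constantCoeff_ne_zero [CharZero f] (lam mu : f) {n : ℕ}
    (P : MvPolynomial ℕ f) (r : f⟦X⟧)
    (H : ∀ h : f⟦X⟧, constantCoeff h ≠ 0 →
      polyEval (substDensity lam mu (1 + X ^ n * r) h) P = polyEval h P) (h : f⟦X⟧) :
    polyEval (substDensity lam mu (1 + X ^ n * r) h) P = polyEval h P := by
  by_cases h0 : constantCoeff h = 0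
  · obtain ⟨p, hp⟩ := exists_polynomial_polyEval (substDensity lam mu (1 + X ^ n * r) h)
      (substDensity lam mu (1 + X ^ n * r) 1) P
    obtain ⟨q, hq⟩ := exists_polynomial_polyEval h 1 P
    -- On the line h + c the hypothesis applies for c ≠ 0 only; the factor `Polynomial.X` makes the
    -- identity trivial at c = 0 and is cancelled afterwards.
    have hpq : Polynomial.X * p = Polynomial.X * q := by
      refine Polynomial.funext fun c => ?_
      rw [Polynomial.eval_mul, Polynomial.eval_mul, Polynomial.eval_X]
      by_cases hc : c = 0
      · rw [hc, zero_mul, zero_mul]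
      · rw [hp, hq, ← substDensity_smul, ← substDensity_add, H]
        rw [map_add, h0, zero_add, smul_eq_C_mul]
        simpa using hc
    have := congrArg (Polynomial.eval 0) (mul_left_cancel₀ Polynomial.X_ne_zero hpq)
    rwa [hp, hq, zero_smul, zero_smul, add_zero, add_zero] at this
  · exact H h h0

end Lines

/-! ### Coefficients of powers of series -/

section PowersOfSeries

variable {A : Type*} [CommRing A]

/-- For r > 0, V^r - W^r is V - W, of order at least m + 1, times a sum of products of r - 1 series
without constant term. -/
theorem coeff_pow_sub_pow_eq_zero {V W : A⟦X⟧} (hV : X ∣ V) (hW : X ∣ W) {m : ℕ}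
    (hVW : X ^ (m + 1) ∣ V - W) {n r : ℕ} (h : n < m + r) : coeff n (V ^ r - W ^ r) = 0 := by
  cases r with
  | zero => simp
  | succ r =>
    have hd : (X : A⟦X⟧) ^ (m + r + 1) ∣ V ^ (r + 1) - W ^ (r + 1) := by
      rw [← (Commute.all V W).geom_sum₂_mul, show m + r + 1 = r + (m + 1) by ring, pow_add]
      refine mul_dvd_mul (Finset.dvd_sum fun i hi => ?_) hVW
      have hi' := Finset.mem_range.1 hi
      have e : (X : A⟦X⟧) ^ r = X ^ i * X ^ (r + 1 - 1 - i) := by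
        rw [← pow_add]; congr 1; omega
      rw [e]
      exact mul_dvd_mul (pow_dvd_pow_of_dvd hV _) (pow_dvd_pow_of_dvd hW _)
    exact X_pow_dvd_iff.1 hd n (by omega)

theorem coeff_pow_mem_of_filtration {S : Type*} [CommRing S] [Algebra S A] {F : ℕ → Subalgebra S A}
    (hF : Monotone F) {V : A⟦X⟧} (hV : ∀ n, coeff n V ∈ F n) (r n : ℕ) : coeff n (V ^ r) ∈ F n := by
  induction r generalizing n with
  | zero =>
    rw [pow_zero, coeff_one]
    split_ifs
    exacts [one_mem _, zero_mem _]
  | succ r ih =>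
    rw [pow_succ, coeff_mul]
    refine sum_mem fun p hp => mul_mem (hF ?_ (ih p.1)) (hF ?_ (hV p.2))
    all_goals have := Finset.HasAntidiagonal.mem_antidiagonal.1 hp; omega

theorem derivation_coeff_pow {S : Type*} [CommRing S] [Algebra S A] (d : Derivation S A A)
    {V V' : A⟦X⟧} (hV : ∀ n, d (coeff n V) = coeff n V') (r n : ℕ) :
    d (coeff n (V ^ (r + 1))) = (r + 1) * coeff n (V ^ r * V') := by
  induction r generalizing n with
  | zero => simp [hV]
  | succ r ih =>
    have e : d (coeff n (V ^ (r + 1) * V)) =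
        coeff n (V ^ (r + 1) * V') + (r + 1) * coeff n (V ^ r * V' * V) := by
      rw [coeff_mul, map_sum, coeff_mul, coeff_mul, Finset.mul_sum, ← Finset.sum_add_distrib]
      refine Finset.sum_congr rfl fun p _ => ?_
      rw [Derivation.leibniz, ih, hV, smul_eq_mul, smul_eq_mul]
      ring
    rw [pow_succ, e, show V ^ r * V' * V = V ^ (r + 1) * V' by ring]
    push_cast
    ring

/-- If `W(z) = x⁻¹ V(x z)`, then `W ^ r` has coefficients `x ^ (n - r)` times those of `V ^ r`. -/
theorem coeff_pow_of_rescale_eq [IsDomain A] {V W : A⟦X⟧} {x : A} (hx : x ≠ 0)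
    (h : rescale x V = C x * W) {r n : ℕ} (hr : r ≤ n) :
    coeff n (W ^ r) = x ^ (n - r) * coeff n (V ^ r) := by
  apply mul_left_cancel₀ (pow_ne_zero r hx)
  rw [← mul_assoc, ← pow_add, Nat.add_sub_cancel' hr, ← coeff_rescale, map_pow (rescale x), h,
    mul_pow, ← map_pow C, coeff_C_mul]

end PowersOfSeries

/-! ### The residue as a polynomial in the coefficients -/

section Residues

variable (f : Type*) [Field f]

/-- The series `∑ i ≥ 1, x_i z ^ i`. -/
noncomputable def tailSeries : (MvPolynomial ℕ f)⟦X⟧ :=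
  PowerSeries.mk fun i => if i = 0 then 0 else MvPolynomial.X i

/-- The sum of the terms of `tailSeries` with `i ≤ m`. -/
noncomputable def tailSeriesTrunc (m : ℕ) : (MvPolynomial ℕ f)⟦X⟧ :=
  PowerSeries.mk fun i => if i ≤ m then coeff i (tailSeries f) else 0

theorem constantCoeff_tailSeries : constantCoeff (tailSeries f) = 0 := by
  rw [← coeff_zero_eq_constantCoeff_apply, tailSeries, coeff_mk, if_pos rfl]

theorem constantCoeff_tailSeriesTrunc (m : ℕ) : constantCoeff (tailSeriesTrunc f m) = 0 := by
  rw [← coeff_zero_eq_constantCoeff_apply, tailSeriesTrunc, coeff_mk, if_pos m.zero_le,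
    coeff_zero_eq_constantCoeff_apply, constantCoeff_tailSeries]

theorem constantCoeff_genSeries : constantCoeff (genSeries f) = 1 := by
  rw [← coeff_zero_eq_constantCoeff_apply, genSeries, coeff_mk, if_pos rfl]

theorem constantCoeff_genSeriesTrunc (m : ℕ) : constantCoeff (genSeriesTrunc f m) = 1 := by
  rw [← coeff_zero_eq_constantCoeff_apply, genSeriesTrunc, coeff_mk, if_pos m.zero_le,
    coeff_zero_eq_constantCoeff_apply, constantCoeff_genSeries]

theorem rescale_tailSeries : rescale (MvPolynomial.X 0) (tailSeries f) =
    C (MvPolynomial.X 0) * (genSeries f - 1) := by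
  ext1 n
  rw [coeff_rescale, coeff_C_mul, map_sub, tailSeries, genSeries, coeff_mk, coeff_mk, coeff_one]
  cases n with
  | zero => simp
  | succ n => simp; ring

theorem rescale_tailSeriesTrunc (m : ℕ) : rescale (MvPolynomial.X 0) (tailSeriesTrunc f m) =
    C (MvPolynomial.X 0) * (genSeriesTrunc f m - 1) := by
  ext1 n
  have h := congrArg (coeff n) (rescale_tailSeries f)
  rw [coeff_rescale, coeff_C_mul, map_sub] at h
  rw [coeff_rescale, coeff_C_mul, map_sub, tailSeriesTrunc, genSeriesTrunc, coeff_mk, coeff_mk]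
  split_ifs with hn
  · exact h
  · rw [coeff_one, if_neg (by omega)]; simp

theorem X_pow_dvd_tailSeries_sub (m : ℕ) : X ^ (m + 1) ∣ tailSeries f - tailSeriesTrunc f m := by
  rw [X_pow_dvd_iff]
  intro j hj
  rw [map_sub, tailSeriesTrunc, coeff_mk, if_pos (by omega), sub_self]

/-- The coefficient of `z ^ n` in `(∑ i ≥ 1, x_i z ^ i) ^ r`, less its terms in `x_1, ..., x_m`. -/
noncomputable def tailCoeff (m n r : ℕ) : MvPolynomial ℕ f :=
  coeff n (tailSeries f ^ r - tailSeriesTrunc f m ^ r)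

variable {f}

theorem tailCoeff_eq_zero {m n r : ℕ} (h : n < m + r) : tailCoeff f m n r = 0 :=
  coeff_pow_sub_pow_eq_zero (X_dvd_iff.2 (constantCoeff_tailSeries f))
    (X_dvd_iff.2 (constantCoeff_tailSeriesTrunc f m)) (X_pow_dvd_tailSeries_sub f m) h

theorem X_mem_supported_le {i n : ℕ} (h : i ≤ n) :
    (MvPolynomial.X i : MvPolynomial ℕ f) ∈ MvPolynomial.supported f {i : ℕ | i ≤ n} :=
  (MvPolynomial.X_mem_supported (s := {i : ℕ | i ≤ n})).2 h

theorem coeff_tailSeries_mem (n : ℕ) :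
    coeff n (tailSeries f) ∈ MvPolynomial.supported f {i : ℕ | i ≤ n} := by
  rw [tailSeries, coeff_mk]
  split_ifs
  exacts [zero_mem _, X_mem_supported_le le_rfl]

theorem tailCoeff_mem_supported (m n r : ℕ) :
    tailCoeff f m n r ∈ MvPolynomial.supported f {i : ℕ | i ≤ n} := by
  have hF : Monotone fun n : ℕ => MvPolynomial.supported f {i : ℕ | i ≤ n} := fun a b hab =>
    MvPolynomial.supported_mono fun i hi => le_trans hi hab
  rw [tailCoeff, map_sub]
  refine sub_mem (coeff_pow_mem_of_filtration hF coeff_tailSeries_mem r n)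
    (coeff_pow_mem_of_filtration hF (fun i => ?_) r n)
  rw [tailSeriesTrunc, coeff_mk]
  split_ifs
  exacts [coeff_tailSeries_mem i, zero_mem _]

/-- For j > m the truncated series is free of x_j, and the full one has derivative z^j. -/
theorem pderiv_tailCoeff {m n j : ℕ} (hj : m < j) (hjn : j ≤ n) (r : ℕ) :
    MvPolynomial.pderiv j (tailCoeff f m n (r + 1)) =
      (r + 1) * coeff (n - j) (tailSeries f ^ r) := by
  have h1 : ∀ i, MvPolynomial.pderiv j (coeff i (tailSeries f)) =
      coeff i (X ^ j : (MvPolynomial ℕ f)⟦X⟧) := fun i => by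
    rw [tailSeries, coeff_mk, coeff_X_pow]
    split_ifs with h0 hij hij
    · omega
    · rw [map_zero]
    · rw [hij, MvPolynomial.pderiv_X_self]
    · rw [MvPolynomial.pderiv_X_of_ne hij]
  have h2 : ∀ i, MvPolynomial.pderiv j (coeff i (tailSeriesTrunc f m)) =
      coeff i (0 : (MvPolynomial ℕ f)⟦X⟧) := fun i => by
    rw [tailSeriesTrunc, coeff_mk, map_zero]
    split_ifs with him
    · rw [h1, coeff_X_pow, if_neg (by omega)]
    · rw [map_zero]
  rw [tailCoeff, map_sub, map_sub, derivation_coeff_pow _ h1, derivation_coeff_pow _ h2, mul_zero,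
    map_zero, mul_zero, sub_zero, coeff_mul_X_pow', if_pos hjn]

theorem coeff_tailSeries_pow_self (r : ℕ) :
    coeff r (tailSeries f ^ r) = MvPolynomial.X 1 ^ r := by
  obtain ⟨u, hu⟩ := X_dvd_iff.2 (constantCoeff_tailSeries f)
  have h1 : constantCoeff u = MvPolynomial.X 1 := by
    have := congrArg (coeff 1) hu
    rw [show (1 : ℕ) = 0 + 1 from rfl, coeff_succ_X_mul, tailSeries, coeff_mk] at this
    simpa using this.symm
  rw [hu, mul_pow, coeff_X_pow_mul', if_pos le_rfl, Nat.sub_self,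
    coeff_zero_eq_constantCoeff_apply, map_pow, h1]

variable [CharZero f]

theorem coeff_seriesPow_genSeries_sub (a : f) (m n : ℕ) :
    coeff n (seriesPow (genSeries f) a - seriesPow (genSeriesTrunc f m) a) =
      ∑ r ∈ Finset.range (n + 1),
        Ring.choose a r • (MvPolynomial.X 0 ^ (n - r) * tailCoeff f m n r) := by
  rw [map_sub, coeff_seriesPow (constantCoeff_genSeries f),
    coeff_seriesPow (constantCoeff_genSeriesTrunc f m), ← Finset.sum_sub_distrib]
  refine Finset.sum_congr rfl fun r hr => ?_
  have hr' : r ≤ n := by have := Finset.mem_range.1 hr; omega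
  have hx : (MvPolynomial.X 0 : MvPolynomial ℕ f) ≠ 0 := MvPolynomial.X_ne_zero 0
  rw [← smul_sub, coeff_pow_of_rescale_eq hx (rescale_tailSeries f) hr',
    coeff_pow_of_rescale_eq hx (rescale_tailSeriesTrunc f m) hr',
    ← mul_sub, tailCoeff, map_sub]

theorem coeff_seriesPow_genSeries_sub_eq_zero (a : f) {m n : ℕ} (h : n ≤ m) :
    coeff n (seriesPow (genSeries f) a - seriesPow (genSeriesTrunc f m) a) = 0 := by
  rw [coeff_seriesPow_genSeries_sub]
  refine Finset.sum_eq_zero fun r _ => ?_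
  cases r with
  | zero => simp [tailCoeff]
  | succ r => rw [tailCoeff_eq_zero (by omega), mul_zero, smul_zero]

/-- The polynomial `∑ 1 ≤ r ≤ e, (a choose r) x_0 ^ (e - r) S_r`, where `S_r` is the coefficient of
`z ^ (m + k)` in `(∑ i ≥ 1, x_i z ^ i) ^ r`, less its terms in `x_1, ..., x_m`. -/
noncomputable def residuePoly (a : f) (m k e : ℕ) : MvPolynomial ℕ f :=
  ∑ r ∈ Finset.range e, Ring.choose a (r + 1) •
    (MvPolynomial.X 0 ^ (e - (r + 1)) * tailCoeff f m (m + k) (r + 1))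

theorem residuePoly_mem_supported (a : f) (m k e : ℕ) :
    residuePoly a m k e ∈ MvPolynomial.supported f {i : ℕ | i ≤ m + k} :=
  sum_mem fun r _ => Subalgebra.smul_mem _ (mul_mem
    (pow_mem (X_mem_supported_le (Nat.zero_le (m + k))) _)
    (tailCoeff_mem_supported m (m + k) (r + 1))) _

/-- The r-th binomial term carries x_0^(m+k-r), and it vanishes for r > k by order and for e < r ≤ k
by its coefficient. What remains is divisible by x_0^(m+k-e): x_0^m is the denominator of the
generating function, and x_0^(k-e) is the extra factor when the exponent is a small positive
integer. -/
theorem coeff_genSeries_sub_eq_residuePoly {a : f} (m : ℕ) {k e : ℕ} (hek : e ≤ k)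
    (ha : ∀ r, e < r → r ≤ k → Ring.choose a r = 0) :
    coeff (m + k) (seriesPow (genSeries f) a - seriesPow (genSeriesTrunc f m) a) =
      MvPolynomial.X 0 ^ m * (MvPolynomial.X 0 ^ (k - e) * residuePoly a m k e) := by
  rw [coeff_seriesPow_genSeries_sub, Finset.sum_range_succ', residuePoly, Finset.mul_sum,
    Finset.mul_sum]
  have h0 : tailCoeff f m (m + k) 0 = 0 := by simp [tailCoeff]
  rw [h0, mul_zero, smul_zero, add_zero]
  symm
  refine Finset.sum_subset_zero_on_sdiff (Finset.range_subset_range.2 (by omega)) ?_ ?_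
  · intro r hr
    rw [Finset.mem_sdiff, Finset.mem_range, Finset.mem_range] at hr
    by_cases hrk : r + 1 ≤ k
    · rw [ha (r + 1) (by omega) hrk, zero_smul]
    · rw [tailCoeff_eq_zero (by omega), mul_zero, smul_zero]
  · intro r hr
    have hr' := Finset.mem_range.1 hr
    rw [mul_smul_comm, mul_smul_comm, ← mul_assoc, ← mul_assoc, ← pow_add, ← pow_add]
    congr 3
    omega

theorem fracRes_eq {a : f} (m : ℕ) {k e : ℕ} (hek : e ≤ k)
    (ha : ∀ r, e < r → r ≤ k → Ring.choose a r = 0) :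
    fracRes a m k = MvPolynomial.X 0 ^ (k - e) * residuePoly a m k e := by
  rw [fracRes, coeff_genSeries_sub_eq_residuePoly m hek ha, MvPolynomial.X_pow_eq_monomial,
    MvPolynomial.divMonomial_monomial_mul]

theorem fracRes_eq_residuePoly (a : f) (m k : ℕ) : fracRes a m k = residuePoly a m k k := by
  rw [fracRes_eq m le_rfl fun r h h' => absurd h (by omega), Nat.sub_self, pow_zero, one_mul]

theorem X_pow_mul_mk_fracRes (a : f) (m : ℕ) :
    (C (MvPolynomial.X 0) * X) ^ m *
        PowerSeries.mk (fun k => if k = 0 then 0 else fracRes a m k) =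
      seriesPow (genSeries f) a - seriesPow (genSeriesTrunc f m) a := by
  ext1 n
  rw [mul_pow, ← map_pow, mul_assoc, coeff_C_mul, coeff_X_pow_mul']
  split_ifs with h
  · obtain ⟨k, rfl⟩ := Nat.exists_eq_add_of_le h
    rw [Nat.add_sub_cancel_left, coeff_mk]
    split_ifs with hk
    · rw [hk, coeff_seriesPow_genSeries_sub_eq_zero a (by omega), mul_zero]
    · rw [coeff_genSeries_sub_eq_residuePoly m le_rfl fun r h h' => absurd h (by omega),
        Nat.sub_self, pow_zero, one_mul, fracRes_eq_residuePoly]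
  · rw [mul_zero, coeff_seriesPow_genSeries_sub_eq_zero a (by omega)]

theorem pderiv_residuePoly (a : f) {m k j : ℕ} (hj : m < j) (hjk : j ≤ m + k) (e : ℕ) :
    MvPolynomial.pderiv j (residuePoly a m k e) =
      ∑ r ∈ Finset.range e, Ring.choose a (r + 1) • (MvPolynomial.X 0 ^ (e - (r + 1)) *
        (((r : MvPolynomial ℕ f) + 1) * coeff (m + k - j) (tailSeries f ^ r))) := by
  rw [residuePoly, map_sum]
  refine Finset.sum_congr rfl fun r _ => ?_
  rw [Derivation.map_smul, Derivation.leibniz, Derivation.leibniz_pow,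
    MvPolynomial.pderiv_X_of_ne (by omega), smul_zero, smul_zero, smul_zero, add_zero,
    pderiv_tailCoeff hj hjk, smul_eq_mul]

/-- Only the linear term r = 1, which is a x_0^e x_(m+k), involves the last variable. -/
theorem pderiv_residuePoly_last (a : f) (m : ℕ) {k : ℕ} (hk : 0 < k) (e : ℕ) :
    MvPolynomial.pderiv (m + k) (residuePoly a m k (e + 1)) =
      MvPolynomial.C a * MvPolynomial.X 0 ^ e := by
  rw [pderiv_residuePoly a (by omega) le_rfl, Finset.sum_range_succ', Finset.sum_eq_zero]
  · rw [Nat.sub_self, ← MvPolynomial.smul_eq_C_mul]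
    simp
  · intro r _
    rw [Nat.sub_self, coeff_zero_eq_constantCoeff_apply, map_pow, constantCoeff_tailSeries]
    simp

/-- The top term r = e + 1 is the only one without an explicit factor x_0. The index m + k - e is
chosen so that its derivative is a nonzero multiple of x_1^e. -/
theorem not_X_dvd_pderiv_residuePoly {a : f} (m : ℕ) {k e : ℕ} (hek : e + 1 ≤ k)
    (ha : Ring.choose a (e + 1) ≠ 0) :
    ¬ MvPolynomial.X 0 ∣ MvPolynomial.pderiv (m + k - e) (residuePoly a m k (e + 1)) := by
  rw [pderiv_residuePoly a (by omega) (by omega), Finset.sum_range_succ]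
  intro h
  rw [dvd_add_right] at h
  · rw [show m + k - (m + k - e) = e by omega, coeff_tailSeries_pow_self, Nat.sub_self, pow_zero,
      one_mul, MvPolynomial.smul_eq_C_mul] at h
    have hp : Prime (MvPolynomial.X 0 : MvPolynomial ℕ f) := MvPolynomial.X_prime
    have hunit : ∀ c : f, c ≠ 0 → ¬ (MvPolynomial.X 0 : MvPolynomial ℕ f) ∣ MvPolynomial.C c :=
      fun c hc hd => hp.not_isUnit (isUnit_of_dvd_unit hd ((isUnit_iff_ne_zero.2 hc).map _))
    rcases hp.dvd_or_dvd h with h | h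
    · exact hunit _ ha h
    rcases hp.dvd_or_dvd h with h | h
    · refine hunit ((e : f) + 1) (Nat.cast_add_one_ne_zero e) ?_
      simpa using h
    · have := MvPolynomial.X_dvd_X.1 (hp.dvd_of_dvd_pow h)
      omega
  · refine Finset.dvd_sum fun r hr => ?_
    have hr' := Finset.mem_range.1 hr
    exact (Dvd.dvd.mul_right (dvd_pow_self _ (by omega)) _).trans (dvd_smul_of_dvd _ dvd_rfl)

end Residues

/-! ### Invariance of the residue polynomial -/

section ResidueInvariance

variable {f : Type*} [Field f] [CharZero f]

/-- At h the generating series specialises to h(x_0 z) / x_0 with x_0 = h(0): division normalises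
the constant term, and rescaling z clears the denominators. -/
theorem polyEval_coeff_seriesPow_genSeries (a : f) {h : f⟦X⟧} (h0 : constantCoeff h ≠ 0) (n : ℕ) :
    polyEval h (coeff n (seriesPow (genSeries f) a)) =
      constantCoeff h ^ n * coeff n (seriesPow ((constantCoeff h)⁻¹ • h) a) := by
  have e : PowerSeries.map (polyEval h : MvPolynomial ℕ f →+* f) (genSeries f) =
      rescale (constantCoeff h) ((constantCoeff h)⁻¹ • h) := by
    ext i
    rw [coeff_map, genSeries, coeff_mk, coeff_rescale, coeff_smul]
    cases i with
    | zero => simp [h0]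
    | succ i =>
      simp [polyEval]
      field_simp
      ring
  have hc : constantCoeff ((constantCoeff h)⁻¹ • h) = 1 := by
    rw [smul_eq_C_mul, map_mul, constantCoeff_C, inv_mul_cancel₀ h0]
  rw [← coeff_rescale, rescale_seriesPow hc, ← e, ← map_seriesPow _ (constantCoeff_genSeries f),
    coeff_map]
  rfl

theorem polyEval_substDensity_of_mem_supported (lam mu : f) {m : ℕ} (r h : f⟦X⟧)
    {P : MvPolynomial ℕ f} (hP : P ∈ MvPolynomial.supported f {i : ℕ | i ≤ m}) :
    polyEval (substDensity lam mu (1 + X ^ (m + 1) * r) h) P = polyEval h P := by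
  have : MvPolynomial.supported f {i : ℕ | i ≤ m} ≤ AlgHom.equalizer
      (polyEval (substDensity lam mu (1 + X ^ (m + 1) * r) h)) (polyEval h) := by
    refine Algebra.adjoin_le ?_
    rintro _ ⟨i, hi, rfl⟩
    change polyEval _ _ = polyEval _ _
    rw [polyEval, polyEval, MvPolynomial.aeval_X, MvPolynomial.aeval_X,
      coeff_substDensity_of_lt lam mu m.succ_pos r h (Nat.lt_succ_of_le hi)]
  exact this hP

theorem coeff_seriesPow_genSeriesTrunc_mem (a : f) (m n : ℕ) :
    coeff n (seriesPow (genSeriesTrunc f m) a) ∈ MvPolynomial.supported f {i : ℕ | i ≤ m} := by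
  rw [coeff_seriesPow (constantCoeff_genSeriesTrunc f m)]
  refine sum_mem fun r _ => Subalgebra.smul_mem _ ?_ _
  refine coeff_pow_mem_of_filtration (F := fun _ => MvPolynomial.supported f {i : ℕ | i ≤ m})
    monotone_const (fun i => ?_) r n
  rw [map_sub, coeff_one, genSeriesTrunc, coeff_mk, genSeries, coeff_mk]
  refine sub_mem ?_ ?_
  · split_ifs with hi h0
    · exact one_mem _
    · exact mul_mem (X_mem_supported_le hi)
        (pow_mem (X_mem_supported_le (Nat.zero_le m)) _)
    · exact zero_mem _
  · split_ifs
    exacts [one_mem _, zero_mem _]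

/-- Both the residue and its truncated part in x_0, ..., x_m are invariant. Their difference is a
power of x_0 times the polynomial, and x_0 is itself invariant and may be assumed nonzero. -/
theorem residuePoly_mem_groupInvariants {lam mu : f} (hlam : lam ≠ 0) {m k e : ℕ}
    (hmu : mu = ((m : f) + k + 1) * lam) (hek : e ≤ k)
    (ha : ∀ r, e < r → r ≤ k → Ring.choose (-1 / lam) r = 0) :
    residuePoly (-1 / lam) m k e ∈ groupInvariants lam mu (m + 1) := by
  rw [mem_groupInvariants_iff lam mu m.succ_pos]
  intro r
  refine polyEval_eq_of_constantCoeff_ne_zero lam mu _ r fun h h0 => ?_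
  set u : f⟦X⟧ := 1 + X ^ (m + 1) * r with hu
  set h' := substDensity lam mu u h with hh'
  have hc : constantCoeff h' = constantCoeff h := by
    rw [← coeff_zero_eq_constantCoeff_apply, ← coeff_zero_eq_constantCoeff_apply]
    exact coeff_substDensity_of_lt lam mu m.succ_pos r h m.succ_pos
  have h1 : constantCoeff ((constantCoeff h)⁻¹ • h) = 1 := by
    rw [smul_eq_C_mul, map_mul, constantCoeff_C, inv_mul_cancel₀ h0]
  have hgen : polyEval h' (coeff (m + k) (seriesPow (genSeries f) (-1 / lam))) =
      polyEval h (coeff (m + k) (seriesPow (genSeries f) (-1 / lam))) := by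
    rw [polyEval_coeff_seriesPow_genSeries _ h0,
      polyEval_coeff_seriesPow_genSeries _ (hc.symm ▸ h0), hc, hh', ← substDensity_smul,
      coeff_seriesPow_substDensity hlam (by rw [hmu]; push_cast; ring)
        (constantCoeff_one_add_X_pow_mul m.succ_pos r) h1]
  have htrunc := polyEval_substDensity_of_mem_supported lam mu r h
    (coeff_seriesPow_genSeriesTrunc_mem (-1 / lam) m (m + k))
  have key : ∀ g : f⟦X⟧, polyEval g (coeff (m + k) (seriesPow (genSeries f) (-1 / lam))) -
      polyEval g (coeff (m + k) (seriesPow (genSeriesTrunc f m) (-1 / lam))) =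
      constantCoeff g ^ m * (constantCoeff g ^ (k - e) *
        polyEval g (residuePoly (-1 / lam) m k e)) := fun g => by
    have := congrArg (polyEval g) (coeff_genSeries_sub_eq_residuePoly m hek ha)
    rw [map_sub, map_sub] at this
    rw [this, map_mul, map_mul, map_pow, map_pow]
    simp [polyEval]
  have := key h'
  rw [hgen, htrunc, key h, hc] at this
  exact (mul_left_cancel₀ (pow_ne_zero _ h0) (mul_left_cancel₀ (pow_ne_zero _ h0) this)).symm

end ResidueInvariance

/-! ### Partial derivatives, divisibility and antiderivatives -/

section PartialDerivatives

variable {f : Type*} [Field f]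

theorem eval_mem_adjoin {A : Type*} [CommRing A] [Algebra f A] {K B : Subalgebra f A} (hKB : K ≤ B)
    {S : A} (hS : S ∈ B) {G : Polynomial A} (hG : ∀ i, G.coeff i ∈ K) : G.eval S ∈ B := by
  rw [Polynomial.eval_eq_sum, Polynomial.sum_def]
  exact sum_mem fun i _ => mul_mem (hKB (hG i)) (pow_mem hS i)

variable [CharZero f]

theorem mem_supported_iff_pderiv_eq_zero {σ : Type*} {s : Set σ} {P : MvPolynomial σ f} :
    P ∈ MvPolynomial.supported f s ↔ ∀ j ∉ s, MvPolynomial.pderiv j P = 0 := by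
  rw [MvPolynomial.mem_supported]
  constructor
  · exact fun h j hj => MvPolynomial.pderiv_eq_zero_of_notMem_vars fun hv => hj (h hv)
  · intro h j hj
    by_contra hs
    obtain ⟨d, hd, hjd⟩ := (MvPolynomial.mem_vars_iff_mem_support j).1 hj
    have hd0 : d j ≠ 0 := Finsupp.mem_support_iff.1 hjd
    have hle : Finsupp.single j 1 ≤ d :=
      Finsupp.single_le_iff.2 (Nat.one_le_iff_ne_zero.2 hd0)
    have hc := congrArg (MvPolynomial.coeff (d - Finsupp.single j 1)) (h j hs)
    rw [MvPolynomial.coeff_pderiv, tsub_add_cancel_of_le hle, MvPolynomial.coeff_zero] at hc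
    rcases mul_eq_zero.1 hc with hc | hc
    · exact MvPolynomial.mem_support_iff.1 hd hc
    · exact Nat.cast_add_one_ne_zero _ hc

theorem derivation_polynomial_eval {R A : Type*} [CommRing R] [CommRing A] [Algebra R A]
    (d : Derivation R A A) {G : Polynomial A} (hG : ∀ i, d (G.coeff i) = 0) (x : A) :
    d (G.eval x) = G.derivative.eval x * d x := by
  rw [Polynomial.derivative_eval, Polynomial.eval_eq_sum, Polynomial.sum_def, Polynomial.sum_def,
    map_sum, Finset.sum_mul]
  refine Finset.sum_congr rfl fun i _ => ?_
  rw [Derivation.leibniz, hG, smul_zero, add_zero, Derivation.leibniz_pow]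
  simp only [smul_eq_mul, nsmul_eq_mul]
  ring

/-- If `d` kills the coefficients of `G`, and the prime `p` divides `G(x)` but not `d x`, then `p`
divides `G`. -/
theorem prime_dvd_coeff_of_dvd_eval {A : Type*} [CommRing A] [Algebra f A] (d : Derivation f A A)
    {p x : A} (hp : Prime p) (hdp : d p = 0) (hdx : ¬ p ∣ d x) (n : ℕ) (G : Polynomial A)
    (hn : G.natDegree ≤ n) (hG : ∀ i, d (G.coeff i) = 0) (h : p ∣ G.eval x) (i : ℕ) :
    p ∣ G.coeff i := by
  induction n generalizing G i with
  | zero =>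
    rw [Polynomial.eq_C_of_natDegree_le_zero hn] at h ⊢
    rw [Polynomial.eval_C] at h
    rw [Polynomial.coeff_C]
    split_ifs
    exacts [h, dvd_zero _]
  | succ n ih =>
    -- Applying d to G(x) = p y gives G'(x) d x = p d y, and p is prime. The degree drops, so
    -- induction applies to G'; characteristic 0 then passes from G' to the nonconstant coefficients
    -- of G.
    have hd : p ∣ G.derivative.eval x := by
      obtain ⟨y, hy⟩ := h
      have e := derivation_polynomial_eval d hG x
      rw [hy, Derivation.leibniz, hdp, smul_zero, add_zero, smul_eq_mul] at e
      exact (hp.dvd_or_dvd ⟨_, e.symm⟩).resolve_right hdx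
    have hpos : ∀ j, p ∣ G.coeff (j + 1) := by
      intro j
      have hj := ih G.derivative ((Polynomial.natDegree_derivative_le G).trans (by omega))
        (fun k => by
          rw [Polynomial.coeff_derivative, Derivation.leibniz, hG, smul_zero, add_zero,
            ← Nat.cast_succ, Derivation.map_natCast, smul_zero]) hd j
      rw [Polynomial.coeff_derivative] at hj
      have hu : IsUnit ((j : A) + 1) := by
        have := (isUnit_iff_ne_zero.2 (Nat.cast_add_one_ne_zero (R := f) j)).map (algebraMap f A)
        simpa using this
      exact (hu.dvd_mul_right).1 hj
    cases i with
    | succ i => exact hpos i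
    | zero =>
      rw [← Polynomial.divX_mul_X_add G, Polynomial.eval_add, Polynomial.eval_mul,
        Polynomial.eval_C] at h
      refine (dvd_add_right (Dvd.dvd.mul_right ?_ _)).1 h
      rw [Polynomial.eval_eq_sum, Polynomial.sum_def]
      refine Finset.dvd_sum fun j _ => Dvd.dvd.mul_right ?_ _
      rw [Polynomial.coeff_divX]
      exact hpos j

theorem exists_antiderivative {A : Type*} [CommRing A] [Algebra f A] (K : Subalgebra f A)
    (G : Polynomial A) (hG : ∀ i, G.coeff i ∈ K) :
    ∃ H : Polynomial A, (∀ i, H.coeff i ∈ K) ∧ H.derivative = G := by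
  refine ⟨∑ i ∈ Finset.range (G.natDegree + 1),
    Polynomial.monomial (i + 1) (((i : f) + 1)⁻¹ • G.coeff i), fun i => ?_, ?_⟩
  · rw [Polynomial.finsetSum_coeff]
    refine sum_mem fun j _ => ?_
    rw [Polynomial.coeff_monomial]
    split_ifs
    exacts [K.smul_mem (hG j) _, K.zero_mem]
  · rw [Polynomial.derivative_sum]
    conv_rhs => rw [G.as_sum_range]
    refine Finset.sum_congr rfl fun i _ => ?_
    rw [Polynomial.derivative_monomial, Nat.add_sub_cancel]
    congr 1
    rw [smul_mul_assoc, Algebra.smul_def, ← map_natCast (algebraMap f A), mul_left_comm,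
      ← map_mul, Nat.cast_succ, inv_mul_cancel₀ (Nat.cast_add_one_ne_zero i), map_one, mul_one]

end PartialDerivatives

/-! ### Generation by one extra invariant -/

section Generation

variable {f : Type*} [Field f] [CharZero f]

/-- A subalgebra `I` of `f[x_0, ..., x_N]` which is stable under `∂/∂x_N` and in which only the
elements of `f[x_0, ..., x_m]` are free of `x_N` is generated by `x_0, ..., x_m` and any `S` in `I`
such that `∂S/∂x_N` is a power of `x_0` up to a constant and `x_0` does not divide some `∂S/∂x_j`
with `j > m`. -/
theorem exists_eval_eq_of_pderiv {I : Subalgebra f (MvPolynomial ℕ f)} {m N : ℕ} (hmN : m < N)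
    (hI : ∀ P ∈ I, MvPolynomial.pderiv N P = 0 → P ∈ MvPolynomial.supported f {i : ℕ | i ≤ m})
    (hKI : MvPolynomial.supported f {i : ℕ | i ≤ m} ≤ I)
    (hd : ∀ P ∈ I, MvPolynomial.pderiv N P ∈ I)
    {S : MvPolynomial ℕ f} (hS : S ∈ I) {c : f} (hc : c ≠ 0) {d : ℕ}
    (hSN : MvPolynomial.pderiv N S = MvPolynomial.C c * MvPolynomial.X 0 ^ d) {j : ℕ} (hj : m < j)
    (hSj : ¬ MvPolynomial.X 0 ∣ MvPolynomial.pderiv j S) {Q : MvPolynomial ℕ f} (hQ : Q ∈ I) :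
    ∃ G : Polynomial (MvPolynomial ℕ f),
      (∀ i, G.coeff i ∈ MvPolynomial.supported f {i : ℕ | i ≤ m}) ∧ G.eval S = Q := by
  set K := MvPolynomial.supported f {i : ℕ | i ≤ m} with hK
  have hKd : ∀ j, m < j → ∀ P ∈ K, MvPolynomial.pderiv j P = 0 := fun j hj P hP =>
    mem_supported_iff_pderiv_eq_zero.1 hP j (by simpa using hj)
  -- If G(S) = x_0 Q, then x_0 divides every coefficient of G. The quotients stay in K because they
  -- are killed by all ∂/∂x_l with l > m.
  have cancel : ∀ Q : MvPolynomial ℕ f,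
      (∃ G : Polynomial (MvPolynomial ℕ f), (∀ i, G.coeff i ∈ K) ∧
        G.eval S = MvPolynomial.X 0 * Q) →
      ∃ G : Polynomial (MvPolynomial ℕ f), (∀ i, G.coeff i ∈ K) ∧ G.eval S = Q := by
    rintro Q ⟨G, hG, hGS⟩
    have hX : (MvPolynomial.X 0 : MvPolynomial ℕ f) ≠ 0 := MvPolynomial.X_ne_zero 0
    have hX0 : ∀ j, m < j → MvPolynomial.pderiv j (MvPolynomial.X 0 : MvPolynomial ℕ f) = 0 :=
      fun j hj => MvPolynomial.pderiv_X_of_ne (by omega)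
    have hdvd := prime_dvd_coeff_of_dvd_eval (MvPolynomial.pderiv j) MvPolynomial.X_prime
      (hX0 j hj) hSj G.natDegree G le_rfl (fun i => hKd j hj _ (hG i)) ⟨Q, hGS⟩
    obtain ⟨G', rfl⟩ := (Polynomial.C_dvd_iff_dvd_coeff _ _).2 hdvd
    refine ⟨G', fun i => mem_supported_iff_pderiv_eq_zero.2 fun l hl => ?_, ?_⟩
    · have hl' : m < l := by simpa using hl
      have := hKd l hl' _ (hG i)
      rw [Polynomial.coeff_C_mul, Derivation.leibniz, hX0 l hl', smul_zero, add_zero,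
        smul_eq_mul] at this
      exact (mul_eq_zero.1 this).resolve_left hX
    · rw [Polynomial.eval_mul, Polynomial.eval_C] at hGS
      exact mul_left_cancel₀ hX hGS
  have cancel_pow : ∀ (d : ℕ) (Q : MvPolynomial ℕ f),
      (∃ G : Polynomial (MvPolynomial ℕ f), (∀ i, G.coeff i ∈ K) ∧
        G.eval S = MvPolynomial.X 0 ^ d * Q) →
      ∃ G : Polynomial (MvPolynomial ℕ f), (∀ i, G.coeff i ∈ K) ∧ G.eval S = Q := by
    intro d
    induction d with
    | zero => intro Q h; simpa using h
    | succ d ih =>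
      intro Q h
      exact ih Q (cancel _ (by rwa [pow_succ', mul_assoc] at h))
  have main : ∀ (n : ℕ) (Q : MvPolynomial ℕ f), (∀ s, n ≤ s N → Q.coeff s = 0) → Q ∈ I →
      ∃ G : Polynomial (MvPolynomial ℕ f), (∀ i, G.coeff i ∈ K) ∧ G.eval S = Q := by
    intro n
    induction n with
    | zero =>
      intro Q h _
      refine ⟨0, fun i => by simp, ?_⟩
      rw [Polynomial.eval_zero]
      ext s
      rw [h s (Nat.zero_le _), MvPolynomial.coeff_zero]
    | succ n ih =>
      intro Q h hQ
      obtain ⟨G, hG, hGS⟩ := ih (MvPolynomial.pderiv N Q) (fun s hs => by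
        rw [MvPolynomial.coeff_pderiv, h _ (by simpa using hs), zero_mul]) (hd Q hQ)
      obtain ⟨H, hH, rfl⟩ := exists_antiderivative K G hG
      have hHS : H.eval S ∈ I := eval_mem_adjoin hKI hS hH
      -- The factor c x_0^d is ∂S/∂x_N, so ∂/∂x_N of both terms is c x_0^d G(S).
      set P := MvPolynomial.C c * MvPolynomial.X 0 ^ d * Q - H.eval S with hP
      have hX0 : (MvPolynomial.X 0 : MvPolynomial ℕ f) ∈ K := X_mem_supported_le (Nat.zero_le m)
      have hcX : MvPolynomial.C c * MvPolynomial.X 0 ^ d ∈ K :=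
        mul_mem (K.algebraMap_mem c) (pow_mem hX0 d)
      have hPI : P ∈ I := sub_mem (mul_mem (hKI hcX) hQ) hHS
      have hPK : P ∈ K := by
        refine hI P hPI ?_
        rw [hP, map_sub, derivation_polynomial_eval _ (fun i => hKd N hmN _ (hH i)), hGS, hSN,
          Derivation.leibniz, hKd N hmN _ hcX, smul_zero, add_zero, smul_eq_mul]
        ring
      refine cancel_pow d Q ⟨Polynomial.C (MvPolynomial.C c⁻¹) * (H + Polynomial.C P), fun i => ?_, ?_⟩
      · rw [Polynomial.coeff_C_mul, Polynomial.coeff_add, Polynomial.coeff_C]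
        refine mul_mem (K.algebraMap_mem c⁻¹) (add_mem (hH i) ?_)
        split_ifs
        exacts [hPK, K.zero_mem]
      · rw [Polynomial.eval_mul, Polynomial.eval_add, Polynomial.eval_C, Polynomial.eval_C, hP,
          add_sub_cancel, ← mul_assoc, ← mul_assoc, ← MvPolynomial.C_mul, inv_mul_cancel₀ hc,
          MvPolynomial.C_1, one_mul]
  refine main (Q.support.sup (fun s => s N) + 1) Q (fun s hs => ?_) hQ
  by_contra h0
  have := Finset.le_sup (f := fun s : ℕ →₀ ℕ => s N) (MvPolynomial.mem_support_iff.2 h0)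
  omega

end Generation

/-! ### Constraints from the vector fields t^(s+1) d/dt -/

section LieInvariants

variable {f : Type*} [Field f]

theorem liePoly_X_pow_smul_derivative (lam mu : f) (s j : ℕ) :
    liePoly lam mu ((X ^ (s + 1) : f⟦X⟧) • derivative f) (MvPolynomial.X j) =
      if s ≤ j then -MvPolynomial.C (((j - s : ℕ) : f) + mu - lam * (s + 1)) *
        MvPolynomial.X (j - s) else 0 := by
  have hD : ((X ^ (s + 1) : f⟦X⟧) • derivative f) X = X * X ^ s := by
    rw [Derivation.smul_apply, derivative_X, smul_eq_mul, mul_one, pow_succ']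
  have hcoeff : ∀ i, coeff j (lieDensity lam mu ((X ^ (s + 1) : f⟦X⟧) • derivative f) (X ^ i)) =
      if j = i + s then (i : f) + mu - lam * (s + 1) else 0 := by
    intro i
    have hX : X * derivative f (X ^ s : f⟦X⟧) = C (s : f) * X ^ s := by
      rw [Derivation.leibniz_pow, derivative_X, map_natCast]
      simp only [smul_eq_mul, nsmul_eq_mul, mul_one]
      cases s with
      | zero => simp
      | succ s => rw [Nat.add_sub_cancel]; ring
    have e : X ^ i * (C ((i : f) + mu) * X ^ s - C lam * (X ^ s + X * derivative f (X ^ s))) =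
        C ((i : f) + mu - lam * (s + 1)) * X ^ (i + s) := by
      rw [hX, pow_add]
      simp only [map_add, map_sub, map_mul, map_one]
      ring
    rw [lieDensity_X_pow lam mu _ hD, e, coeff_C_mul, coeff_X_pow]
    split_ifs <;> simp
  rw [liePoly, MvPolynomial.mkDerivation_X]
  simp only [hcoeff]
  split_ifs with hsj
  · rw [Finset.sum_eq_single_of_mem (j - s) (Finset.mem_range.2 (by omega)),
      if_pos (by omega), MvPolynomial.smul_eq_C_mul, neg_mul]
    intro i _ hi
    rw [if_neg (by omega), zero_smul]
  · rw [Finset.sum_eq_zero, neg_zero]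
    intro i _
    rw [if_neg (by omega), zero_smul]

theorem X_pow_smul_derivative_mem {n s : ℕ} (h : n ≤ s) :
    (X ^ (s + 1) : f⟦X⟧) • derivative f ∈ vectorFields f n := by
  change X ^ (n + 1) ∣ ((X ^ (s + 1) : f⟦X⟧) • derivative f) X
  rw [Derivation.smul_apply, derivative_X, smul_eq_mul, mul_one]
  exact pow_dvd_pow _ (by omega)

/-- An invariant in `x_0, ..., x_M` does not involve `x_M`, if some vector field moves `x_M` alone
among these variables. -/
theorem pderiv_eq_zero_of_liePoly {lam mu : f} {n M s : ℕ} (hs : n ≤ s) (hsM : s ≤ M)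
    (hlow : ∀ j, s ≤ j → j < M → ((j - s : ℕ) : f) + mu - lam * (s + 1) = 0)
    (hM : ((M - s : ℕ) : f) + mu - lam * (s + 1) ≠ 0) {P : MvPolynomial ℕ f}
    (hP : P ∈ lieInvariants lam mu n) (hPM : P ∈ MvPolynomial.supported f {i : ℕ | i ≤ M}) :
    MvPolynomial.pderiv M P = 0 := by
  set y : MvPolynomial ℕ f := -MvPolynomial.C (((M - s : ℕ) : f) + mu - lam * (s + 1)) *
    MvPolynomial.X (M - s) with hy
  have hy0 : y ≠ 0 := by
    rw [hy, neg_mul, neg_ne_zero]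
    exact mul_ne_zero (MvPolynomial.C_ne_zero.2 hM) (MvPolynomial.X_ne_zero _)
  have e : liePoly lam mu ((X ^ (s + 1) : f⟦X⟧) • derivative f) P =
      (y • MvPolynomial.pderiv M) P := by
    refine MvPolynomial.derivation_eqOn_supported (fun j hj => ?_) hPM
    simp only [Function.comp_apply]
    have hj' : j ≤ M := hj
    rw [liePoly_X_pow_smul_derivative, Derivation.smul_apply]
    rcases hj'.lt_or_eq with h | rfl
    · rw [MvPolynomial.pderiv_X_of_ne h.ne, smul_zero]
      split_ifs with hsj
      · rw [hlow j hsj h]; simp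
      · rfl
    · rw [if_pos hsM, MvPolynomial.pderiv_X_self, smul_eq_mul, mul_one]
  rw [hP _ (X_pow_smul_derivative_mem hs), Derivation.smul_apply, smul_eq_mul] at e
  exact (mul_eq_zero.1 e.symm).resolve_left hy0

/-- A field in L_n with n > 0 sends x_j to a combination of x_i with i < j, so for j ≤ N the image
is free of x_N. Hence the field commutes with ∂/∂x_N on f[x_0, ..., x_N]. -/
theorem pderiv_mem_lieInvariants {lam mu : f} {n N : ℕ} (hn : 0 < n) {P : MvPolynomial ℕ f}
    (hP : P ∈ lieInvariants lam mu n) (hPN : P ∈ MvPolynomial.supported f {i : ℕ | i ≤ N}) :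
    MvPolynomial.pderiv N P ∈ lieInvariants lam mu n := by
  intro D hD
  obtain ⟨r, hr⟩ := id hD
  have hDX : D X = X * (X ^ n * r) := by rw [hr]; ring
  have hρ : constantCoeff (X ^ n * r) = 0 := by simp [hn.ne']
  have hcomm : ⁅liePoly lam mu D, MvPolynomial.pderiv N⁆ P = (0 : Derivation f _ _) P := by
    refine MvPolynomial.derivation_eqOn_supported (fun j hj => ?_) hPN
    have hj' : j ≤ N := hj
    simp only [Function.comp_apply]
    rw [Derivation.commutator_apply, Derivation.zero_apply]
    have h1 : liePoly lam mu D (MvPolynomial.pderiv N (MvPolynomial.X j)) = 0 := by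
      by_cases h : j = N
      · rw [h, MvPolynomial.pderiv_X_self, Derivation.map_one_eq_zero]
      · rw [MvPolynomial.pderiv_X_of_ne h, map_zero]
    rw [h1, zero_sub, liePoly, MvPolynomial.mkDerivation_X, map_neg, neg_neg, map_sum]
    refine Finset.sum_eq_zero fun i hi => ?_
    have hi' := Finset.mem_range.1 hi
    rw [Derivation.map_smul]
    by_cases h : i = N
    · obtain rfl : j = i := by omega
      rw [lieDensity_X_pow lam mu D hDX, coeff_X_pow_mul', if_pos le_rfl, Nat.sub_self]
      simp [hρ, hn.ne']
    · rw [MvPolynomial.pderiv_X_of_ne h, smul_zero]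
  rw [Derivation.commutator_apply, hP D hD, map_zero, sub_zero, Derivation.zero_apply] at hcomm
  exact hcomm

variable [CharZero f]

theorem mem_supported_of_pderiv_eq_zero {M : ℕ} {P : MvPolynomial ℕ f}
    (hP : P ∈ MvPolynomial.supported f {i : ℕ | i ≤ M + 1})
    (h : MvPolynomial.pderiv (M + 1) P = 0) : P ∈ MvPolynomial.supported f {i : ℕ | i ≤ M} := by
  refine mem_supported_iff_pderiv_eq_zero.2 fun j hj => ?_
  have hj' : M < j := by simpa using hj
  rcases (Nat.succ_le_of_lt hj').lt_or_eq with h' | rfl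
  · exact mem_supported_iff_pderiv_eq_zero.1 hP j (by simpa using h')
  · exact h

theorem mem_supported_of_descent {B : ℕ} {P : MvPolynomial ℕ f}
    (h : ∀ M, B ≤ M → P ∈ MvPolynomial.supported f {i : ℕ | i ≤ M + 1} →
      MvPolynomial.pderiv (M + 1) P = 0) : P ∈ MvPolynomial.supported f {i : ℕ | i ≤ B} := by
  have step : ∀ t, P ∈ MvPolynomial.supported f {i : ℕ | i ≤ B + t} →
      P ∈ MvPolynomial.supported f {i : ℕ | i ≤ B} := by
    intro t
    induction t with
    | zero => exact id
    | succ t ih =>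
      exact fun ht => ih (mem_supported_of_pderiv_eq_zero ht (h (B + t) (by omega) ht))
  refine step (P.vars.sup id) (MvPolynomial.mem_supported.2 fun i hi => ?_)
  exact (Finset.le_sup (f := id) hi).trans (Nat.le_add_left _ _)

end LieInvariants

/-! ### The four cases -/

section Main

variable {f : Type*} [Field f]

theorem adjoin_X_eq_supported (m : ℕ) :
    Algebra.adjoin f {x : MvPolynomial ℕ f | ∃ i ≤ m, x = MvPolynomial.X i} =
      MvPolynomial.supported f {i : ℕ | i ≤ m} := by
  rw [MvPolynomial.supported_eq_adjoin_X]
  congr 1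
  ext x
  exact ⟨fun ⟨i, hi, hx⟩ => ⟨i, hi, hx.symm⟩, fun ⟨i, hi, hx⟩ => ⟨i, hi, hx.symm⟩⟩

variable [CharZero f]

theorem supported_le_groupInvariants (lam mu : f) (m : ℕ) :
    MvPolynomial.supported f {i : ℕ | i ≤ m} ≤ groupInvariants lam mu (m + 1) := fun _ hP =>
  (mem_groupInvariants_iff lam mu m.succ_pos _).2 fun r h =>
    polyEval_substDensity_of_mem_supported lam mu r h hP

theorem mem_supported_of_mem_lieInvariants {lam mu : f} {m B : ℕ} (hB : m ≤ B)
    (h : ∀ M, B ≤ M → mu ≠ ((M : f) + 2) * lam) {P : MvPolynomial ℕ f}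
    (hP : P ∈ lieInvariants lam mu (m + 1)) : P ∈ MvPolynomial.supported f {i : ℕ | i ≤ B} := by
  -- The field with s = M + 1 kills x_0, ..., x_M and sends x_(M+1) to ((M+2)λ - μ) x_0.
  refine mem_supported_of_descent fun M hM hPM =>
    pderiv_eq_zero_of_liePoly (s := M + 1) (by omega) le_rfl (fun j h1 h2 => by omega) ?_ hP hPM
  intro h0
  refine h M hM ?_
  rw [Nat.sub_self] at h0
  push_cast at h0
  linear_combination h0

theorem invariants_generic {lam mu : f} {m : ℕ}
    (h : ∀ k : ℕ, 0 < k → mu ≠ ((m : f) + k + 1) * lam) :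
    lieInvariants lam mu (m + 1) ≤ MvPolynomial.supported f {i : ℕ | i ≤ m} := fun _ hP => by
  refine mem_supported_of_mem_lieInvariants le_rfl (fun M hM => ?_) hP
  obtain ⟨k, rfl⟩ := Nat.exists_eq_add_of_le hM
  convert h (k + 1) k.succ_pos using 2
  push_cast; ring

theorem lieInvariants_zero_le (m : ℕ) :
    lieInvariants (0 : f) 0 (m + 1) ≤ MvPolynomial.supported f {i : ℕ | i ≤ m + 1} := fun _ hP => by
  -- For λ = μ = 0 the previous field also kills x_(M+1). The field with s = M still kills x_0, ...,
  -- x_M but sends x_(M+1) to -x_1; it is available only for M ≥ m + 1, so x_(m+1) survives.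
  refine mem_supported_of_descent fun M hM hPM =>
    pderiv_eq_zero_of_liePoly (s := M) hM M.le_succ (fun j h1 h2 => ?_) ?_ hP hPM
  · rw [show j - M = 0 by omega]; simp
  · simp

theorem supported_le_groupInvariants_zero (m : ℕ) :
    MvPolynomial.supported f {i : ℕ | i ≤ m + 1} ≤ groupInvariants (0 : f) 0 (m + 1) := by
  refine Algebra.adjoin_le ?_
  rintro _ ⟨i, hi, rfl⟩
  refine (mem_groupInvariants_iff 0 0 m.succ_pos _).2 fun r h => ?_
  rw [polyEval, polyEval, MvPolynomial.aeval_X, MvPolynomial.aeval_X,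
    coeff_substDensity_zero m.succ_pos r h (Nat.lt_succ_of_le hi)]

theorem invariants_residue {lam mu : f} (hlam : lam ≠ 0) {m k e : ℕ}
    (hmu : mu = ((m : f) + k + 1) * lam) (hek : e + 1 ≤ k)
    (ha : ∀ r, e + 1 < r → r ≤ k → Ring.choose (-1 / lam) r = 0)
    (hae : Ring.choose (-1 / lam) (e + 1) ≠ 0) :
    lieInvariants lam mu (m + 1) = groupInvariants lam mu (m + 1) ∧
      groupInvariants lam mu (m + 1) = Algebra.adjoin f
        ({x | ∃ i ≤ m, x = MvPolynomial.X i} ∪ {residuePoly (-1 / lam) m k (e + 1)}) := by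
  set S := residuePoly (-1 / lam) m k (e + 1) with hS
  set B := Algebra.adjoin f ({x | ∃ i ≤ m, x = MvPolynomial.X i} ∪ {S}) with hB
  set K := MvPolynomial.supported f {i : ℕ | i ≤ m} with hK
  have hGL : groupInvariants lam mu (m + 1) ≤ lieInvariants lam mu (m + 1) :=
    groupInvariants_le_lieInvariants lam mu m.succ_pos
  have hKG : K ≤ groupInvariants lam mu (m + 1) := supported_le_groupInvariants lam mu m
  have hSG : S ∈ groupInvariants lam mu (m + 1) :=
    residuePoly_mem_groupInvariants hlam hmu hek ha
  have hKB : K ≤ B := by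
    rw [hK, ← adjoin_X_eq_supported]
    exact Algebra.adjoin_mono Set.subset_union_left
  have hBG : B ≤ groupInvariants lam mu (m + 1) := by
    refine Algebra.adjoin_le ?_
    rintro _ (⟨i, hi, rfl⟩ | rfl)
    exacts [hKG (X_mem_supported_le hi), hSG]
  have hne : ∀ M : ℕ, M + 2 ≠ m + k + 1 → mu ≠ ((M : f) + 2) * lam := by
    intro M hM h
    rw [hmu] at h
    have := mul_right_cancel₀ hlam h
    exact hM (by exact_mod_cast this.symm)
  have hN : ∀ P ∈ lieInvariants lam mu (m + 1),
      P ∈ MvPolynomial.supported f {i : ℕ | i ≤ m + k} := fun P hP =>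
    mem_supported_of_mem_lieInvariants (Nat.le_add_right m k)
      (fun M hM => hne M (by omega)) hP
  have hLB : lieInvariants lam mu (m + 1) ≤ B := by
    intro Q hQ
    have ha0 : -1 / lam ≠ 0 := div_ne_zero (neg_ne_zero.2 one_ne_zero) hlam
    obtain ⟨G, hG, rfl⟩ := exists_eval_eq_of_pderiv (N := m + k) (by omega)
      -- The descent passes every index except the resonant m + k, where the assumed vanishing of
      -- ∂P/∂x_(m+k) replaces the vector field.
      (fun P hP h0 => mem_supported_of_descent fun M hM hPM => by
        rcases lt_trichotomy (M + 1) (m + k) with h | h | h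
        · refine pderiv_eq_zero_of_liePoly (s := M + 1) (by omega) le_rfl
            (fun j h1 h2 => by omega) ?_ hP hPM
          intro h0
          refine hne M (by omega) ?_
          rw [Nat.sub_self] at h0
          push_cast at h0
          linear_combination h0
        · rw [h]; exact h0
        · exact mem_supported_iff_pderiv_eq_zero.1 (hN P hP) _ (by simpa using h))
      (hKG.trans hGL) (fun P hP => pderiv_mem_lieInvariants m.succ_pos hP (hN P hP)) (hGL hSG) ha0
      (pderiv_residuePoly_last _ m (by omega) e) (j := m + k - e) (by omega)
      (not_X_dvd_pderiv_residuePoly m hek hae) hQ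
    exact eval_mem_adjoin hKB (Algebra.subset_adjoin (Or.inr rfl)) hG
  exact ⟨le_antisymm (hLB.trans hBG) hGL, le_antisymm (hGL.trans hLB) hBG⟩

theorem choose_ne_zero {a : f} {k : ℕ} (h : ∀ n : ℕ, n < k → a ≠ n) : Ring.choose a k ≠ 0 := by
  induction k with
  | zero => simp
  | succ k ih =>
    intro h0
    have e := succ_mul_choose_add a k
    rw [h0, mul_zero, zero_add] at e
    exact h k k.lt_succ_self (mul_right_cancel₀ (ih fun n hn => h n (by omega)) e.symm)

/-- Here C(-1/λ, k) ≠ 0, since -1/λ is none of 0, ..., k - 1, so the sum runs up to r = k and no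
power of x_0 splits off. -/
theorem invariants_residue_of_forall_ne {lam mu : f} (hlam : lam ≠ 0) {m k : ℕ} (hk : 0 < k)
    (hmu : mu = ((m : f) + k + 1) * lam) (h : ∀ n : ℕ, 0 < n → n < k → -1 / lam ≠ n) :
    lieInvariants lam mu (m + 1) = groupInvariants lam mu (m + 1) ∧
      groupInvariants lam mu (m + 1) = Algebra.adjoin f
        ({x | ∃ i ≤ m, x = MvPolynomial.X i} ∪ {fracRes (-1 / lam) m k}) := by
  obtain ⟨e, rfl⟩ := Nat.exists_eq_succ_of_ne_zero hk.ne'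
  rw [fracRes_eq_residuePoly]
  refine invariants_residue hlam hmu le_rfl (fun r h1 h2 => absurd h1 (by omega))
    (choose_ne_zero fun n hn => ?_)
  rcases n.eq_zero_or_pos with rfl | hn0
  · rw [Nat.cast_zero]
    exact div_ne_zero (neg_ne_zero.2 one_ne_zero) hlam
  · exact h n hn0 hn

/-- The binomial coefficients C(n, r) stop at r = n with C(n, n) = 1, so exactly x_0^(k-n) has to be
removed before the generation argument applies. -/
theorem invariants_residue_of_eq {lam mu : f} (hlam : lam ≠ 0) {m k n : ℕ}
    (hmu : mu = ((m : f) + k + 1) * lam) (hn : 0 < n) (hnk : n < k) (h : -1 / lam = n) :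
    lieInvariants lam mu (m + 1) = groupInvariants lam mu (m + 1) ∧
      ∃ Q : MvPolynomial ℕ f, MvPolynomial.X 0 ^ (k - n) * Q = fracRes (n : f) m k ∧
        groupInvariants lam mu (m + 1) =
          Algebra.adjoin f ({x | ∃ i ≤ m, x = MvPolynomial.X i} ∪ {Q}) := by
  obtain ⟨e, rfl⟩ := Nat.exists_eq_succ_of_ne_zero hn.ne'
  have ha : ∀ r, e + 1 < r → r ≤ k → Ring.choose (-1 / lam) r = 0 := fun r hr _ => by
    rw [h, Ring.choose_natCast, Nat.choose_eq_zero_of_lt hr, Nat.cast_zero]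
  have hae : Ring.choose (-1 / lam) (e + 1) ≠ 0 := by
    rw [h, Ring.choose_natCast, Nat.choose_self, Nat.cast_one]
    exact one_ne_zero
  obtain ⟨h1, h2⟩ := invariants_residue hlam hmu hnk.le ha hae
  exact ⟨h1, _, by rw [← h]; exact (fracRes_eq m hnk.le ha).symm, h2⟩

theorem lieInvariants_eq_groupInvariants (lam mu : f) (m : ℕ) :
    lieInvariants lam mu (m + 1) = groupInvariants lam mu (m + 1) := by
  have hGL : groupInvariants lam mu (m + 1) ≤ lieInvariants lam mu (m + 1) :=
    groupInvariants_le_lieInvariants lam mu m.succ_pos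
  by_cases hgen : ∀ k : ℕ, 0 < k → mu ≠ ((m : f) + k + 1) * lam
  · exact le_antisymm ((invariants_generic hgen).trans (supported_le_groupInvariants lam mu m)) hGL
  push Not at hgen
  obtain ⟨k, hk, hmu⟩ := hgen
  by_cases hlam : lam = 0
  · subst hlam
    rw [mul_zero] at hmu
    subst hmu
    exact le_antisymm ((lieInvariants_zero_le m).trans (supported_le_groupInvariants_zero m)) hGL
  by_cases h : ∀ n : ℕ, 0 < n → n < k → -1 / lam ≠ n
  · exact (invariants_residue_of_forall_ne hlam hk hmu h).1
  · push Not at h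
    obtain ⟨n, hn, hnk, h⟩ := h
    exact (invariants_residue_of_eq hlam hmu hn hnk h).1

end Main

end FormalDensity

open FormalDensity in
theorem theorem4 {f : Type*} [Field f] [CharZero f] (lam mu : f) (m : ℕ) :
    -- the group and the Lie algebra have the same polynomial invariants
    lieInvariants lam mu (m + 1) = groupInvariants lam mu (m + 1) ∧
    -- the generic case
    ((∀ k : ℕ, 0 < k → mu ≠ ((m : f) + k + 1) * lam) →
      groupInvariants lam mu (m + 1) =
        Algebra.adjoin f {x | ∃ i ≤ m, x = MvPolynomial.X i}) ∧
    -- the case of functions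
    (lam = 0 → mu = 0 →
      groupInvariants lam mu (m + 1) =
        Algebra.adjoin f {x | ∃ i ≤ m + 1, x = MvPolynomial.X i}) ∧
    -- the generating function defines polynomials `P_{mk}` in `x_0, ..., x_{m+k}`
    (lam ≠ 0 →
      (∀ k : ℕ, 0 < k →
        fracRes (-1 / lam) m k ∈ MvPolynomial.supported f {i : ℕ | i ≤ m + k}) ∧
      (PowerSeries.C (MvPolynomial.X 0) * PowerSeries.X) ^ m *
          PowerSeries.mk (fun k => if k = 0 then 0 else fracRes (-1 / lam) m k) =
        seriesPow (genSeries f) (-1 / lam) - seriesPow (genSeriesTrunc f m) (-1 / lam)) ∧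
    -- the cases with a fractional residue
    (∀ k : ℕ, 0 < k → lam ≠ 0 → mu = ((m : f) + k + 1) * lam →
      ((∀ n : ℕ, 0 < n → n < k → -1 / lam ≠ n) →
        groupInvariants lam mu (m + 1) =
          Algebra.adjoin f ({x | ∃ i ≤ m, x = MvPolynomial.X i} ∪ {fracRes (-1 / lam) m k})) ∧
      (∀ n : ℕ, 0 < n → n < k → -1 / lam = n →
        ∃ Q : MvPolynomial ℕ f, MvPolynomial.X 0 ^ (k - n) * Q = fracRes (n : f) m k ∧
          groupInvariants lam mu (m + 1) =
            Algebra.adjoin f ({x | ∃ i ≤ m, x = MvPolynomial.X i} ∪ {Q})))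
    := by
  refine ⟨lieInvariants_eq_groupInvariants lam mu m, fun h => ?_, fun hlam hmu => ?_,
    fun _ => ⟨fun k _ => ?_, X_pow_mul_mk_fracRes _ m⟩, fun k hk hlam hmu =>
    ⟨fun h => (invariants_residue_of_forall_ne hlam hk hmu h).2,
      fun n hn hnk h => (invariants_residue_of_eq hlam hmu hn hnk h).2⟩⟩
  · rw [adjoin_X_eq_supported]
    exact le_antisymm ((groupInvariants_le_lieInvariants lam mu m.succ_pos).trans
      (invariants_generic h)) (supported_le_groupInvariants lam mu m)
  · subst hlam hmu
    rw [adjoin_X_eq_supported]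
    exact le_antisymm ((groupInvariants_le_lieInvariants 0 0 m.succ_pos).trans
      (lieInvariants_zero_le m)) (supported_le_groupInvariants_zero m)
  · rw [fracRes_eq_residuePoly]
    exact residuePoly_mem_supported _ m k k
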